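/- Let $\Phi_{\rm b}$ (base stations) be a homogeneous Poisson point process in $\mathbb{R}^2$ with intensity $\lambda_{\rm b}>0$. Let $\Phi_{\rm u}$ (users) be a Poisson cluster process (PCP), independent of $\Phi_{\rm b}$: the parents ${\bf z}$ form a homogeneous Poisson point process of intensity $\lambda_{\rm p}>0$, each parent independently has a Poisson number, with mean $\bar m\ge 0$, of offspring, and the offspring of ${\bf z}$ are placed at ${\bf z}+{\bf s}$, where the displacements ${\bf s}$ are i.i.d. with probability density $f$ on $\mathbb{R}^2$; $\Phi_{\rm u}$ consists of all offspring. Put $\lambda_{\rm u}=\bar m\lambda_{\rm p}$. Condition $\Phi_{\rm b}$ (in the sense of Palm) to have a point at the origin $o$, keeping $\Phi_{\rm u}$ independent of it, let ${\cal C}_o=\{{\bf y}:\|{\bf y}\|\le\|{\bf y}-{\bf t}\|\ \forall\,{\bf t}\in\Phi_{\rm b}\}$ be the Voronoi cell of $o$, and let $\Phi_{{\rm u}_0}=\Phi_{\rm u}({\cal C}_o)$ be the typical cell load, i.e. the number of users in ${\cal C}_o$. Then $\Phi_{{\rm u}_0}$ is a random variable with finite second moment and $$\mathbb{E}[\Phi_{{\rm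 u}_0}]=\frac{\bar m\lambda_{\rm p}}{\lambda_{\rm b}}.$$ Moreover, let $\varrho^{(2)}:\mathbb{R}\to[0,\infty]$ be any second-order moment density of $\Phi_{\rm u}$ depending on distance only, i.e. any measurable function with $$\mathbb{E}[\Phi_{\rm u}(A)\Phi_{\rm u}(B)]=\mathbb{E}[\Phi_{\rm u}(A\cap B)]+\int_A\int_B\varrho^{(2)}(\|{\bf x}_1-{\bf x}_2\|)\,{\rm d}{\bf x}_2\,{\rm d}{\bf x}_1$$ for all Borel sets $A,B\subset\mathbb{R}^2$. Then $$\mathbb{E}[\Phi_{{\rm u}_0}^2]=\frac{\lambda_{\rm u}}{\lambda_{\rm b}}+2\pi\int_0^{2\pi}\int_0^\infty\int_0^\infty \exp\bigl(-\lambda_{\rm b}A_{\rm u}(x_1,x_2,d(x_1,x_2,\theta))\bigr)\,\varrho^{(2)}(d(x_1,x_2,\theta))\,x_1x_2\,{\rm d}x_1\,{\rm d}x_2\,{\rm d}\theta,$$ where $d(x_1,x_2,\theta)=(x_1^2+x_2^2-2x_1x_2\cos\theta)^{1/2}$ and $A_{\rm u}(R_1,R_2,r)$ is the area of the union of two discs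 of radii $R_1$ and $R_2$ whose centres are at distance $r$. If $f$ is isotropic (that is, $f({\bf s})$ depends only on $\|{\bf s}\|$), such a density exists and is given by $$\varrho^{(2)}(r)=\lambda_{\rm u}^2\bigl(1+\lambda_{\rm p}^{-1}g(r)\bigr),\qquad g(r)=\int_{\mathbb{R}^2}f({\bf z})f({\bf z}+{\bf x})\,{\rm d}{\bf z}\quad\text{for any }{\bf x}\text{ with }\|{\bf x}\|=r .$$ -/

import Mathlib

open MeasureTheory ProbabilityTheory Set
open scoped NNReal ENNReal

noncomputable section

/-- The Euclidean plane. -/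
abbrev Plane : Type := EuclideanSpace ℝ (Fin 2)

/-- A (random) counting measure `Φ` on the plane, measurable for the σ-algebra generated by the
evaluations `Φ ↦ Φ A`, with almost surely finite integer counts on all bounded Borel sets. -/
structure IsPointProcess {Ω : Type*} [MeasurableSpace Ω] (P : Measure Ω)
    (Φ : Ω → Measure Plane) : Prop where
  measurable : Measurable Φ
  counting : ∀ᵐ ω ∂P, ∀ A : Set Plane, MeasurableSet A → Bornology.IsBounded A →
    ∃ n : ℕ, Φ ω A = n

/-- Homogeneous Poisson point process in the plane, of intensity `lam`. -/
structure IsPoissonPP {Ω : Type*} [MeasurableSpace Ω] (P : Measure Ω)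
    (Φ : Ω → Measure Plane) (lam : ℝ≥0) : Prop extends IsPointProcess P Φ where
  /-- the number of points in a Borel set of finite area is Poisson distributed -/
  law_count : ∀ A : Set Plane, MeasurableSet A → volume A < ∞ →
    HasLaw (fun ω => Φ ω A)
      ((poissonMeasure (lam * (volume A).toNNReal)).map (Nat.cast : ℕ → ℝ≥0∞)) P
  /-- the numbers of points in disjoint Borel sets are independent -/
  indep : ∀ (n : ℕ) (A : Fin n → Set Plane), (∀ i, MeasurableSet (A i)) →
    Pairwise (fun i j => Disjoint (A i) (A j)) → iIndepFun (fun i ω => Φ ω (A i)) P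

/-- Poisson cluster process with parent intensity `lamP`, mean cluster size `m` and offspring
density `f`: the points are `Z i + S i j` for `j < N i`, where `Z 0, Z 1, …` are the points of a
Poisson process of intensity `lamP` (the parents), the cluster sizes `N i` are Poisson with mean
`m`, the displacements `S i j` have density `f`, all the `N i` and `S i j` are independent, and
they are jointly independent of the parents. -/
def IsPoissonClusterProcess {Ω : Type*} [MeasurableSpace Ω] (P : Measure Ω)
    (Φ : Ω → Measure Plane) (lamP m : ℝ≥0) (f : Plane → ℝ≥0) : Prop :=
  ∃ (Z : ℕ → Ω → Plane) (N : ℕ → Ω → ℕ) (S : ℕ → ℕ → Ω → Plane),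
    (∀ i, Measurable (Z i)) ∧ (∀ i, Measurable (N i)) ∧ (∀ i j, Measurable (S i j)) ∧
    IsPoissonPP P (fun ω => Measure.sum fun i => Measure.dirac (Z i ω)) lamP ∧
    (∀ i, HasLaw (N i) (poissonMeasure m) P) ∧
    (∀ i j, HasLaw (S i j) (volume.withDensity fun s => (f s : ℝ≥0∞)) P) ∧
    IndepFun (fun ω i => Z i ω) (fun ω i => (N i ω, fun j => S i j ω)) P ∧
    iIndepFun (fun i ω => (N i ω, fun j => S i j ω)) P ∧
    (∀ i, IndepFun (N i) (fun ω j => S i j ω) P) ∧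
    (∀ i, iIndepFun (S i) P) ∧
    ∀ ω, Φ ω = Measure.sum fun i => ∑ j ∈ Finset.range (N i ω), Measure.dirac (Z i ω + S i j ω)

/-- `Φ₀` is distributed as the stationary point process `Φ` of intensity `lam` seen from its
typical point, that is, as `Φ` conditioned (in the sense of Palm) to have a point at the origin:
`lam * |B| * P₀(Φ₀ ∈ F)` is the mean number of points `x ∈ B` of `Φ` with `Φ - x ∈ F`. -/
structure HasPalmLaw {Ω' : Type*} [MeasurableSpace Ω'] (P' : Measure Ω')
    (Φ : Ω' → Measure Plane) (lam : ℝ≥0)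
    {Ω : Type*} [MeasurableSpace Ω] (P : Measure Ω) (Φ₀ : Ω → Measure Plane) : Prop where
  measurable : Measurable Φ₀
  palm : ∀ (B : Set Plane) (F : Set (Measure Plane)), MeasurableSet B → MeasurableSet F →
    (lam : ℝ≥0∞) * volume B * P (Φ₀ ⁻¹' F) =
      ∫⁻ ω, Φ ω {x | x ∈ B ∧ (Φ ω).map (fun t => t - x) ∈ F} ∂P'

/-- The Voronoi cell of `x` with respect to the points (atoms) of the counting measure `φ`. -/
def voronoiCell (φ : Measure Plane) (x : Plane) : Set Plane :=
  {y | ∀ t : Plane, φ {t} ≠ 0 → ‖y - x‖ ≤ ‖y - t‖}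

/-- `ρ` is the second-order moment density of `Φ`, as a function of the distance: off the
diagonal, the second moment measure `A × B ↦ E[Φ(A) Φ(B)]` has density `ρ ‖x₁ - x₂‖`, and its
diagonal part is the intensity measure. -/
structure IsSecondMomentDensity {Ω : Type*} [MeasurableSpace Ω] (P : Measure Ω)
    (Φ : Ω → Measure Plane) (ρ : ℝ → ℝ≥0∞) : Prop where
  measurable : Measurable ρ
  moment : ∀ A B : Set Plane, MeasurableSet A → MeasurableSet B →
    ∫⁻ ω, Φ ω A * Φ ω B ∂P =
      ∫⁻ ω, Φ ω (A ∩ B) ∂P + ∫⁻ x₁ in A, ∫⁻ x₂ in B, ρ ‖x₁ - x₂‖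

/-- The explicit density `(lamP m)² (1 + g(r) / lamP)`, where `g(r) = ∫ f(z) f(z + x) dz` for a
vector `x` of length `r`. -/
def clusterMomentDensity (lamP m : ℝ≥0) (f : Plane → ℝ≥0) (r : ℝ) : ℝ≥0∞ :=
  ((m * lamP : ℝ≥0) : ℝ≥0∞) ^ 2 *
    (1 + (lamP : ℝ≥0∞)⁻¹ *
      ∫⁻ z : Plane, (f z : ℝ≥0∞) * (f (z + EuclideanSpace.single (0 : Fin 2) r) : ℝ≥0∞))

/-- Area of the union of two discs of radii `R₁`, `R₂` with centres at distance `r`. -/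
def unionArea (R₁ R₂ r : ℝ) : ℝ :=
  volume.real (Metric.closedBall (0 : Plane) R₁ ∪
    Metric.closedBall (EuclideanSpace.single (0 : Fin 2) r) R₂)

/-- Third side of a triangle with sides `x₁`, `x₂` enclosing the angle `θ`. -/
def thirdSide (x₁ x₂ θ : ℝ) : ℝ :=
  Real.sqrt (x₁ ^ 2 + x₂ ^ 2 - 2 * x₁ * x₂ * Real.cos θ)

end

/-! The load is the number of users in a random set independent of the users, so by Tonelli the cell
may be frozen while the user moments are taken (`lintegral_comp_load`). The first moment is then the
user intensity times the mean area of the cell.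

A point y lies in the cell exactly when the open disc about y through the origin contains no base
station. That disc omits the origin, and away from the origin the Palm version has the void
probabilities of the original process (Slivnyak). Hence y lies in the cell with probability exp(-λ_b
π‖y‖²), and the mean area is a Gaussian integral equal to 1/λ_b. Likewise x and y both lie in the
cell with probability exp(-λ_b |D_x ∪ D_y|), where D_x and D_y are the two discs. Putting this into
the second moment measure of the users gives a double integral over the plane whose integrand
depends only on ‖x‖, ‖y‖ and ‖x - y‖; polar coordinates turn it into the stated triple integral.

Slivnyak's theorem is needed only for the event that an open set U of finite area omitting the
origin is empty (`HasPalmLaw.measure_void`). In the Palm identity the moving set x + U is replaced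
by countably many fixed sets, each disjoint from the small cell in which x is counted. Independence
evaluates the approximations, and dominated convergence gives the limit.

The second moment measure of the users comes from conditioning on the parents: distinct clusters are
independent, and a single Poisson cluster contributes its factorial moments. What remains are second
moments of linear functionals of the parent process. In the resulting formula offspring
probabilities are at most 1, which bounds the second moment of Φ_u(A) by a quadratic polynomial in
the area of A; the squared cell area is integrable, so the load has a finite second moment.

Two measurability points need care. The cell is defined through atoms, whereas measurable events see
only masses of sets; the two descriptions agree for integer-valued measures. Evaluating one random
measure on an independent random set is measurable because the users can be presented by an s-finite
kernel. -/

/-! ### Polar coordinates, isometries and the Gaussian integral in the plane. -/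

section PlaneIntegrals

/-- The point of the plane with polar coordinates `s`, `θ`. -/
noncomputable def polarPoint (s θ : ℝ) : Plane := !₂[s * Real.cos θ, s * Real.sin θ]

lemma continuous_polarPoint : Continuous fun p : ℝ × ℝ => polarPoint p.1 p.2 := by
  unfold polarPoint
  refine (PiLp.continuous_toLp 2 _).comp ?_
  refine continuous_pi fun i => ?_
  fin_cases i
  · simp; fun_prop
  · simp; fun_prop

lemma continuous_single_zero :
    Continuous fun r : ℝ => (EuclideanSpace.single (0 : Fin 2) r : Plane) := by
  have : (fun r : ℝ => (EuclideanSpace.single (0 : Fin 2) r : Plane)) =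
      fun r => polarPoint r 0 := by
    ext r i
    fin_cases i <;> simp [polarPoint]
  rw [this]
  exact continuous_polarPoint.comp (by fun_prop : Continuous fun r : ℝ => (r, (0 : ℝ)))

lemma norm_polarPoint {s : ℝ} (hs : 0 ≤ s) (θ : ℝ) : ‖polarPoint s θ‖ = s := by
  rw [EuclideanSpace.norm_eq]
  simp only [polarPoint, Real.norm_eq_abs, sq_abs, Fin.sum_univ_two]
  rw [Real.sqrt_eq_iff_mul_self_eq (by positivity) hs]
  simp
  nlinarith [Real.sin_sq_add_cos_sq θ]

lemma norm_single_sub_polarPoint (r s θ : ℝ) :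
    ‖EuclideanSpace.single (0 : Fin 2) r - polarPoint s θ‖ = thirdSide r s θ := by
  rw [EuclideanSpace.norm_eq, thirdSide]
  congr 1
  simp only [polarPoint, Real.norm_eq_abs, sq_abs, Fin.sum_univ_two]
  simp
  nlinarith [Real.sin_sq_add_cos_sq θ]

lemma polarPoint_add_two_pi (s θ : ℝ) : polarPoint s (θ + 2 * Real.pi) = polarPoint s θ := by
  simp [polarPoint]

/-- Both intervals are fundamental domains for translation by multiples of 2π. This moves the angle
range of `polarCoord` to the one used in the theorem. -/
lemma lintegral_Ioc_neg_pi_pi_eq {F : ℝ → ℝ≥0∞} (hF : ∀ θ, F (θ + 2 * Real.pi) = F θ) :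
    ∫⁻ θ in Ioc (-Real.pi) Real.pi, F θ = ∫⁻ θ in Ioc 0 (2 * Real.pi), F θ := by
  have hT : 0 < 2 * Real.pi := by positivity
  have : VAddInvariantMeasure (AddSubgroup.zmultiples (2 * Real.pi)) ℝ volume :=
    ⟨fun c s _ => measure_preimage_add _ _ _⟩
  have h := IsAddFundamentalDomain.setLIntegral_eq
    (G := AddSubgroup.zmultiples (2 * Real.pi)) (isAddFundamentalDomain_Ioc hT (-Real.pi))
    (isAddFundamentalDomain_Ioc hT 0) F (Function.Periodic.map_vadd_zmultiples hF)
  rw [zero_add] at h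
  rw [← h]
  congr 3
  ring

/-- Integration over the plane in polar coordinates. -/
lemma lintegral_plane_eq_polar {F : Plane → ℝ≥0∞} (hF : Measurable F) :
    ∫⁻ y, F y = ∫⁻ θ in Ioc 0 (2 * Real.pi), ∫⁻ s in Ioi (0 : ℝ),
      ENNReal.ofReal s * F (polarPoint s θ) := by
  have hmp : MeasurePreserving
      (fun p : ℝ × ℝ => (WithLp.toLp 2 (MeasurableEquiv.finTwoArrow.symm p) : Plane)) :=
    (PiLp.volume_preserving_toLp (Fin 2)).comp (volume_preserving_finTwoArrow ℝ).symm
  have hm : Measurable fun p : ℝ × ℝ => ENNReal.ofReal p.1 * F (polarPoint p.1 p.2) :=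
    (ENNReal.measurable_ofReal.comp measurable_fst).mul
      (hF.comp continuous_polarPoint.measurable)
  rw [← hmp.lintegral_comp hF, ← lintegral_comp_polarCoord_symm]
  have : ∀ p : ℝ × ℝ, (WithLp.toLp 2 (MeasurableEquiv.finTwoArrow.symm (polarCoord.symm p)) :
      Plane) = polarPoint p.1 p.2 := by
    intro p
    ext i
    fin_cases i <;> simp [polarPoint]
  simp_rw [this, smul_eq_mul]
  rw [polarCoord_target, Measure.volume_eq_prod, ← Measure.prod_restrict,
    lintegral_prod_symm _ hm.aemeasurable]
  rw [← lintegral_Ioc_neg_pi_pi_eq (fun θ => by simp_rw [polarPoint_add_two_pi]),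
    restrict_Ioo_eq_restrict_Ioc]

/-- The reflection in the line through the origin orthogonal to x - y exchanges two vectors of equal
length. -/
lemma exists_isometry_map_eq {x y : Plane} (h : ‖x‖ = ‖y‖) :
    ∃ O : Plane ≃ₗᵢ[ℝ] Plane, O x = y :=
  ⟨Submodule.reflection (Submodule.span ℝ {x - y})ᗮ, Submodule.reflection_sub h⟩

/-- Circles are null, so open discs may be replaced by closed ones; a translation followed by a
linear isometry then puts the centres at the origin and on the first axis. -/
lemma volume_ball_union_ball (x y : Plane) (R₁ R₂ : ℝ) :
    volume (Metric.ball x R₁ ∪ Metric.ball y R₂) =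
      ENNReal.ofReal (unionArea R₁ R₂ ‖x - y‖) := by
  have hcl : ∀ (c : Plane) (R : ℝ), Metric.ball c R =ᵐ[volume] Metric.closedBall c R := by
    intro c R
    refine ae_eq_of_subset_of_measure_ge Metric.ball_subset_closedBall ?_ ?_ ?_
    · rw [EuclideanSpace.volume_closedBall_fin_two, EuclideanSpace.volume_ball_fin_two]
    · exact Metric.isOpen_ball.measurableSet.nullMeasurableSet
    · rw [EuclideanSpace.volume_closedBall_fin_two]
      exact ENNReal.mul_ne_top (ENNReal.pow_ne_top ENNReal.ofReal_ne_top) ENNReal.ofReal_ne_top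
  obtain ⟨O, hO⟩ := exists_isometry_map_eq
    (show ‖y - x‖ = ‖EuclideanSpace.single (0 : Fin 2) ‖x - y‖‖ by simp [norm_sub_rev])
  have hmp : MeasurePreserving (fun t => O (t - x)) (volume : Measure Plane) volume :=
    O.measurePreserving.comp (measurePreserving_sub_right volume x)
  rw [measure_congr ((hcl x R₁).union (hcl y R₂)), unionArea, Measure.real,
    ENNReal.ofReal_toReal, ← hmp.measure_preimage (s := Metric.closedBall (0 : Plane) R₁ ∪
      Metric.closedBall (EuclideanSpace.single (0 : Fin 2) ‖x - y‖) R₂)]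
  · congr 1
    ext t
    simp only [mem_union, mem_preimage, Metric.mem_closedBall, dist_eq_norm, sub_zero,
      LinearIsometryEquiv.norm_map]
    rw [← hO, ← map_sub, LinearIsometryEquiv.norm_map, sub_sub_sub_cancel_right]
  · exact (Metric.isClosed_closedBall.union
      Metric.isClosed_closedBall).measurableSet.nullMeasurableSet
  · exact ((measure_union_le _ _).trans_lt
      (ENNReal.add_lt_top.2 ⟨measure_closedBall_lt_top, measure_closedBall_lt_top⟩)).ne

/-- Double integration of a function of a triangle with one vertex at the origin. -/
lemma lintegral_lintegral_norm_eq {h : ℝ → ℝ → ℝ → ℝ≥0∞} {H : Plane → Plane → ℝ≥0∞}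
    (hH : Measurable (Function.uncurry H)) (hh : ∀ x y, H x y = h ‖x‖ ‖y‖ ‖x - y‖) :
    ∫⁻ x : Plane, ∫⁻ y : Plane, H x y =
      ENNReal.ofReal (2 * Real.pi) *
        ∫⁻ θ in Ioc 0 (2 * Real.pi), ∫⁻ x₂ in Ioi (0 : ℝ), ∫⁻ x₁ in Ioi (0 : ℝ),
          h x₁ x₂ (thirdSide x₁ x₂ θ) * ENNReal.ofReal (x₁ * x₂) := by
  have hHx : ∀ x, Measurable (H x) := fun x => hH.of_uncurry_left
  set K : Plane → ℝ≥0∞ := fun x => ∫⁻ y : Plane, H x y with hK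
  have hKm : Measurable K := hH.lintegral_prod_right
  -- The inner integral is radial, since an isometry moving x to y can be absorbed in the inner
  -- variable. So x may be placed on the first axis, and its own polar angle contributes only the
  -- factor 2π.
  have hKO : ∀ x y : Plane, ‖x‖ = ‖y‖ → K x = K y := by
    intro x y hxy
    obtain ⟨O, hO⟩ := exists_isometry_map_eq hxy
    rw [hK]
    simp only
    rw [← O.measurePreserving.lintegral_comp (hHx y)]
    refine lintegral_congr fun z => ?_
    rw [hh, hh, ← hO, ← map_sub, LinearIsometryEquiv.norm_map, LinearIsometryEquiv.norm_map,
      LinearIsometryEquiv.norm_map]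
  set G : ℝ → ℝ → ℝ → ℝ≥0∞ := fun x₁ x₂ θ => ENNReal.ofReal x₁ * (ENNReal.ofReal x₂ *
    H (EuclideanSpace.single (0 : Fin 2) x₁) (polarPoint x₂ θ)) with hG
  have hGm : Measurable fun p : ℝ × ℝ × ℝ => G p.1 p.2.1 p.2.2 :=
    (ENNReal.measurable_ofReal.comp measurable_fst).mul
      ((ENNReal.measurable_ofReal.comp (measurable_fst.comp measurable_snd)).mul
        (hH.comp ((continuous_single_zero.measurable.comp measurable_fst).prodMk
          (continuous_polarPoint.measurable.comp measurable_snd))))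
  have h1 : ∫⁻ x, K x = ∫⁻ θ in Ioc 0 (2 * Real.pi), ∫⁻ s in Ioi (0 : ℝ),
      ENNReal.ofReal s * K (EuclideanSpace.single (0 : Fin 2) s) := by
    rw [lintegral_plane_eq_polar hKm]
    refine lintegral_congr fun θ => setLIntegral_congr_fun measurableSet_Ioi fun s hs => ?_
    rw [hKO (polarPoint s θ) (EuclideanSpace.single (0 : Fin 2) s)]
    rw [norm_polarPoint (le_of_lt hs)]
    simp [abs_of_pos (mem_Ioi.1 hs)]
  have h2 : ∀ s : ℝ, ENNReal.ofReal s * K (EuclideanSpace.single (0 : Fin 2) s) =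
      ∫⁻ θ in Ioc 0 (2 * Real.pi), ∫⁻ x₂ in Ioi (0 : ℝ), G s x₂ θ := by
    intro s
    rw [hK]
    simp only
    rw [lintegral_plane_eq_polar (hHx _), ← lintegral_const_mul']
    · refine lintegral_congr fun θ => ?_
      rw [← lintegral_const_mul' _ _ ENNReal.ofReal_ne_top]
    · exact ENNReal.ofReal_ne_top
  rw [h1, lintegral_const, Measure.restrict_apply_univ, Real.volume_Ioc, sub_zero, mul_comm]
  congr 1
  simp_rw [h2]
  rw [lintegral_lintegral_swap]
  · refine lintegral_congr fun θ => ?_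
    rw [lintegral_lintegral_swap]
    · refine setLIntegral_congr_fun measurableSet_Ioi fun x₂ hx₂ => ?_
      refine setLIntegral_congr_fun measurableSet_Ioi fun x₁ hx₁ => ?_
      simp only [hG]
      rw [hh, norm_single_sub_polarPoint, norm_polarPoint (le_of_lt hx₂), ENNReal.ofReal_mul
        (le_of_lt hx₁), PiLp.norm_single, Real.norm_eq_abs, abs_of_pos (mem_Ioi.1 hx₁)]
      ring
    · exact (hGm.comp (by fun_prop : Measurable fun q : ℝ × ℝ => (q.1, q.2, θ))).aemeasurable
  · refine Measurable.aemeasurable ?_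
    exact Measurable.lintegral_prod_right' (f := fun q : (ℝ × ℝ) × ℝ => G q.1.1 q.2 q.1.2)
      (hGm.comp (by fun_prop : Measurable fun q : (ℝ × ℝ) × ℝ => (q.1.1, q.2, q.1.2)))

lemma measurable_volume_ball_union :
    Measurable fun p : Plane × Plane =>
      volume (Metric.ball p.1 ‖p.1‖ ∪ Metric.ball p.2 ‖p.2‖) := by
  have : MeasurableSet {q : (Plane × Plane) × Plane |
      dist q.2 q.1.1 < ‖q.1.1‖ ∨ dist q.2 q.1.2 < ‖q.1.2‖} := by
    rw [ofPred_or]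
    exact (measurableSet_lt (by fun_prop) (by fun_prop)).union
      (measurableSet_lt (by fun_prop) (by fun_prop))
  exact measurable_measure_prodMk_left (ν := (volume : Measure Plane)) this

lemma lintegral_exp_neg_volume_ball {c : ℝ} (hc : 0 < c) :
    ∫⁻ x : Plane, ENNReal.ofReal (Real.exp (-(c * volume.real (Metric.ball x ‖x‖)))) =
      ENNReal.ofReal c⁻¹ := by
  have hb : 0 < c * Real.pi := by positivity
  have h := GaussianFourier.integral_rexp_neg_mul_sq_norm (V := Plane) hb
  have hint : Integrable fun v : Plane => Real.exp (-(c * Real.pi) * ‖v‖ ^ 2) := by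
    -- The Bochner integral of a non-integrable function is 0, but the Gaussian formula gives a
    -- positive value.
    by_contra hn
    rw [integral_undef hn] at h
    have : 0 < (Real.pi / (c * Real.pi)) ^ ((Module.finrank ℝ Plane : ℝ) / 2) := by positivity
    exact this.ne h
  have hv : ∀ x : Plane, -(c * volume.real (Metric.ball x ‖x‖)) =
      -(c * Real.pi) * ‖x‖ ^ 2 := by
    intro x
    rw [Measure.real, EuclideanSpace.volume_ball_fin_two, ENNReal.toReal_mul, ENNReal.toReal_pow,
      ENNReal.toReal_ofReal (norm_nonneg x), ENNReal.toReal_ofReal Real.pi_pos.le]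
    ring
  simp_rw [hv]
  rw [← ofReal_integral_eq_lintegral_ofReal hint
    (Filter.Eventually.of_forall fun x => by positivity), h]
  congr 1
  simp
  field_simp

end PlaneIntegrals

/-! ### Moments of the Poisson distribution. -/

section PoissonMoments

lemma poissonMeasure_singleton_succ_mul (r : ℝ≥0) (n : ℕ) :
    poissonMeasure r {n + 1} * ((n + 1 : ℕ) : ℝ≥0∞) = r * poissonMeasure r {n} := by
  rw [poissonMeasure_singleton, poissonMeasure_singleton, ← ENNReal.ofReal_natCast,
    ← ENNReal.ofReal_coe_nnreal, ← ENNReal.ofReal_mul (by positivity),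
    ← ENNReal.ofReal_mul (by positivity)]
  congr 1
  rw [Nat.factorial_succ]
  push_cast
  field_simp
  ring

/-- The Chen–Stein identity for the Poisson distribution. -/
lemma lintegral_mul_poissonMeasure (r : ℝ≥0) (g : ℕ → ℝ≥0∞) :
    ∫⁻ n, (n : ℝ≥0∞) * g n ∂poissonMeasure r = r * ∫⁻ n, g (n + 1) ∂poissonMeasure r := by
  rw [lintegral_countable', lintegral_countable', tsum_eq_zero_add' ENNReal.summable,
    ← ENNReal.tsum_mul_left]
  simp only [Nat.cast_zero, zero_mul, zero_add]
  refine tsum_congr fun n => ?_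
  rw [mul_assoc, mul_left_comm, mul_comm ((n + 1 : ℕ) : ℝ≥0∞),
    poissonMeasure_singleton_succ_mul]
  ring

lemma lintegral_natCast_poissonMeasure (r : ℝ≥0) :
    ∫⁻ n, (n : ℝ≥0∞) ∂poissonMeasure r = r := by
  simpa using lintegral_mul_poissonMeasure r fun _ => 1

lemma lintegral_natCast_mul_pred_poissonMeasure (r : ℝ≥0) :
    ∫⁻ n, (n : ℝ≥0∞) * ((n - 1 : ℕ) : ℝ≥0∞) ∂poissonMeasure r = r ^ 2 := by
  rw [lintegral_mul_poissonMeasure r fun n => ((n - 1 : ℕ) : ℝ≥0∞)]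
  simp only [Nat.add_sub_cancel, lintegral_natCast_poissonMeasure]
  ring

lemma lintegral_natCast_sq_poissonMeasure (r : ℝ≥0) :
    ∫⁻ n, (n : ℝ≥0∞) * n ∂poissonMeasure r = r ^ 2 + r := by
  rw [lintegral_mul_poissonMeasure r fun n => (n : ℝ≥0∞)]
  push_cast
  rw [lintegral_add_right _ measurable_const, lintegral_natCast_poissonMeasure]
  simp
  ring

end PoissonMoments

/-! ### First and second moments of linear functionals of a Poisson process. -/

lemma ennreal_iSup_mul_iSup_of_monotone {f g : ℕ → ℝ≥0∞} (hf : Monotone f) (hg : Monotone g) :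
    (⨆ n, f n) * ⨆ n, g n = ⨆ n, f n * g n := by
  refine le_antisymm ?_ (iSup_le fun n => mul_le_mul' (le_iSup f n) (le_iSup g n))
  simp_rw [ENNReal.iSup_mul, ENNReal.mul_iSup]
  refine iSup₂_le fun i j => le_iSup_of_le (max i j) ?_
  exact mul_le_mul' (hf (le_max_left _ _)) (hg (le_max_right _ _))

section PoissonProcess

variable {Ω : Type*} [MeasurableSpace Ω] {P : Measure Ω} {Φ : Ω → Measure Plane} {lam : ℝ≥0}

namespace IsPoissonPP

lemma measurable_count (h : IsPoissonPP P Φ lam) {A : Set Plane} (hA : MeasurableSet A) :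
    Measurable fun ω => Φ ω A :=
  (Measure.measurable_coe hA).comp h.measurable

lemma measurable_setLIntegral (h : IsPoissonPP P Φ lam) {D : Set Plane} (hD : MeasurableSet D)
    {u : Plane → ℝ≥0∞} (hu : Measurable u) : Measurable fun ω => ∫⁻ x in D, u x ∂Φ ω := by
  have := (Measure.measurable_lintegral (hu.indicator hD)).comp h.measurable
  simpa only [Function.comp_def, lintegral_indicator hD] using this

lemma lintegral_comp_count (h : IsPoissonPP P Φ lam) {A : Set Plane} (hA : MeasurableSet A)
    (hv : volume A < ∞) {g : ℝ≥0∞ → ℝ≥0∞} (hg : Measurable g) :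
    ∫⁻ ω, g (Φ ω A) ∂P = ∫⁻ n, g n ∂poissonMeasure (lam * (volume A).toNNReal) := by
  rw [(h.law_count A hA hv).lintegral_comp hg.aemeasurable, lintegral_map hg .of_discrete]

lemma lintegral_count (h : IsPoissonPP P Φ lam) {A : Set Plane} (hA : MeasurableSet A)
    (hv : volume A < ∞) : ∫⁻ ω, Φ ω A ∂P = lam * volume A := by
  rw [h.lintegral_comp_count hA hv (g := fun x => x) measurable_id,
    lintegral_natCast_poissonMeasure, ENNReal.coe_mul, ENNReal.coe_toNNReal hv.ne]

lemma lintegral_count_mul_self (h : IsPoissonPP P Φ lam) {A : Set Plane} (hA : MeasurableSet A)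
    (hv : volume A < ∞) :
    ∫⁻ ω, Φ ω A * Φ ω A ∂P = (lam * volume A) ^ 2 + lam * volume A := by
  rw [h.lintegral_comp_count hA hv (g := fun x => x * x) (by fun_prop),
    lintegral_natCast_sq_poissonMeasure, ENNReal.coe_mul, ENNReal.coe_toNNReal hv.ne]

lemma measure_count_eq_zero (h : IsPoissonPP P Φ lam) {A : Set Plane} (hA : MeasurableSet A)
    (hv : volume A < ∞) :
    P {ω | Φ ω A = 0} = ENNReal.ofReal (Real.exp (-(lam * volume.real A))) := by
  rw [(h.law_count A hA hv).measure_eq (p := fun x => x = 0) (measurableSet_singleton 0),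
    Measure.map_apply .of_discrete (s := {x : ℝ≥0∞ | x = 0}) (measurableSet_singleton 0)]
  have : (Nat.cast ⁻¹' {x : ℝ≥0∞ | x = 0} : Set ℕ) = {0} := by ext n; simp
  rw [this, poissonMeasure_singleton]
  simp [Measure.real, ENNReal.coe_toNNReal_eq_toReal]

lemma indepFun_count (h : IsPoissonPP P Φ lam) {A B : Set Plane} (hA : MeasurableSet A)
    (hB : MeasurableSet B) (hAB : Disjoint A B) :
    IndepFun (fun ω => Φ ω A) (fun ω => Φ ω B) P := by
  have := h.indep 2 ![A, B] (by intro i; fin_cases i <;> assumption) (by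
    intro i j hij
    fin_cases i <;> fin_cases j <;> simp_all [disjoint_comm])
  exact this.indepFun (i := 0) (j := 1) (by simp)

lemma lintegral_count_mul_of_disjoint (h : IsPoissonPP P Φ lam) {A B : Set Plane}
    (hA : MeasurableSet A) (hB : MeasurableSet B) (hAB : Disjoint A B)
    (hAv : volume A < ∞) (hBv : volume B < ∞) :
    ∫⁻ ω, Φ ω A * Φ ω B ∂P = lam * volume A * (lam * volume B) := by
  rw [lintegral_mul_eq_lintegral_mul_lintegral_of_indepFun''
    (h.measurable_count hA).aemeasurable (h.measurable_count hB).aemeasurable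
    (h.indepFun_count hA hB hAB), h.lintegral_count hA hAv, h.lintegral_count hB hBv]

/-- Split A and B along A ∩ B: of the four products, three involve disjoint sets and factor by
independence, and the square of the count in A ∩ B supplies the extra Poisson variance. -/
lemma lintegral_count_mul_of_lt_top (h : IsPoissonPP P Φ lam) {A B : Set Plane}
    (hA : MeasurableSet A) (hB : MeasurableSet B) (hAv : volume A < ∞) (hBv : volume B < ∞) :
    ∫⁻ ω, Φ ω A * Φ ω B ∂P =
      lam * volume A * (lam * volume B) + lam * volume (A ∩ B) := by
  have hsA : ∀ μ : Measure Plane, μ A = μ (A \ B) + μ (A ∩ B) := fun μ =>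
    (measure_sdiff_add_inter A hB).symm
  have hsB : ∀ μ : Measure Plane, μ B = μ (B \ A) + μ (A ∩ B) := fun μ => by
    rw [inter_comm, measure_sdiff_add_inter B hA]
  have hlt : ∀ {s t : Set Plane}, volume t < ∞ → s ⊆ t → volume s < ∞ := fun ht hs =>
    (measure_mono hs).trans_lt ht
  have mA := h.measurable_count hA
  have mB := h.measurable_count hB
  have mX := h.measurable_count (hA.diff hB)
  have mY := h.measurable_count (hB.diff hA)
  have mI := h.measurable_count (hA.inter hB)
  simp_rw [hsA, hsB, add_mul, mul_add]
  rw [lintegral_add_left (by fun_prop), lintegral_add_left (by fun_prop),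
    lintegral_add_left (by fun_prop),
    h.lintegral_count_mul_of_disjoint (hA.diff hB) (hB.diff hA)
      (disjoint_sdiff_sdiff) (hlt hAv sdiff_subset) (hlt hBv sdiff_subset),
    h.lintegral_count_mul_of_disjoint (hA.diff hB) (hA.inter hB)
      (disjoint_sdiff_inter) (hlt hAv sdiff_subset) (hlt hAv inter_subset_left),
    h.lintegral_count_mul_of_disjoint (hA.inter hB) (hB.diff hA)
      (by rw [inter_comm]; exact (disjoint_sdiff_inter).symm) (hlt hAv inter_subset_left)
      (hlt hBv sdiff_subset),
    h.lintegral_count_mul_self (hA.inter hB) (hlt hAv inter_subset_left)]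
  ring

/-- The covariance formula is extended from sets to functions one argument at a time. The window D
keeps areas finite, since the sets met in the induction on u may have infinite area. -/
lemma lintegral_lintegral_mul_count (h : IsPoissonPP P Φ lam) {B : Set Plane}
    (hB : MeasurableSet B) (hBv : volume B < ∞) (D : Set Plane) (hD : MeasurableSet D)
    (hDv : volume D < ∞) {u : Plane → ℝ≥0∞} (hu : Measurable u) :
    ∫⁻ ω, (∫⁻ x in D, u x ∂Φ ω) * Φ ω B ∂P =
      lam * (∫⁻ x in D, u x) * (lam * volume B) + lam * ∫⁻ x in D ∩ B, u x := by
  have hmu : ∀ {u : Plane → ℝ≥0∞}, Measurable u → Measurable fun ω => ∫⁻ x in D, u x ∂Φ ω :=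
    fun hu => h.measurable_setLIntegral hD hu
  have mB := h.measurable_count hB
  refine Measurable.ennreal_induction (motive := fun u =>
    ∫⁻ ω, (∫⁻ x in D, u x ∂Φ ω) * Φ ω B ∂P =
      lam * (∫⁻ x in D, u x) * (lam * volume B) + lam * ∫⁻ x in D ∩ B, u x) ?_ ?_ ?_ hu
  · intro c s hs
    simp_rw [lintegral_indicator_const hs, Measure.restrict_apply hs, mul_assoc]
    rw [lintegral_const_mul _ ((h.measurable_count (hs.inter hD)).fun_mul mB),
      h.lintegral_count_mul_of_lt_top (hs.inter hD) hB
        ((measure_mono inter_subset_right).trans_lt hDv) hBv, inter_assoc]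
    ring
  · intro f g _ hf hg ihf ihg
    simp only [Pi.add_apply]
    simp_rw [lintegral_add_left hf, add_mul]
    rw [lintegral_add_left ((hmu hf).fun_mul mB), ihf, ihg]
    ring
  · intro f hf hmono ih
    simp_rw [lintegral_iSup hf hmono, ENNReal.iSup_mul]
    rw [lintegral_iSup (fun n => (hmu (hf n)).fun_mul mB)
      (fun i j hij ω => mul_le_mul_left (lintegral_mono (hmono hij)) _)]
    simp_rw [ih]
    rw [ENNReal.mul_iSup, ENNReal.mul_iSup, ENNReal.iSup_mul, ENNReal.iSup_add_iSup_of_monotone]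
    · intro i j hij
      dsimp only
      gcongr
      exact hmono hij _
    · intro i j hij
      dsimp only
      gcongr
      exact hmono hij _

lemma lintegral_setLIntegral_mul_setLIntegral (h : IsPoissonPP P Φ lam)
    (D : Set Plane) (hD : MeasurableSet D)
    (hDv : volume D < ∞) {u v : Plane → ℝ≥0∞} (hu : Measurable u) (hv : Measurable v) :
    ∫⁻ ω, (∫⁻ x in D, u x ∂Φ ω) * (∫⁻ x in D, v x ∂Φ ω) ∂P =
      lam * (∫⁻ x in D, u x) * (lam * ∫⁻ x in D, v x) + lam * ∫⁻ x in D, u x * v x := by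
  have hmu : ∀ {u : Plane → ℝ≥0∞}, Measurable u → Measurable fun ω => ∫⁻ x in D, u x ∂Φ ω :=
    fun hu => h.measurable_setLIntegral hD hu
  have mU := hmu hu
  refine Measurable.ennreal_induction (motive := fun v =>
    ∫⁻ ω, (∫⁻ x in D, u x ∂Φ ω) * (∫⁻ x in D, v x ∂Φ ω) ∂P =
      lam * (∫⁻ x in D, u x) * (lam * ∫⁻ x in D, v x) + lam * ∫⁻ x in D, u x * v x) ?_ ?_ ?_ hv
  · intro c s hs
    simp_rw [lintegral_indicator_const hs, Measure.restrict_apply hs, mul_left_comm _ c]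
    rw [lintegral_const_mul _ (mU.fun_mul (h.measurable_count (hs.inter hD))),
      h.lintegral_lintegral_mul_count (hs.inter hD)
        ((measure_mono inter_subset_right).trans_lt hDv) D hD hDv hu]
    have : ∀ x, u x * s.indicator (fun _ => c) x = s.indicator (fun x => c * u x) x := by
      intro x
      by_cases hx : x ∈ s <;> simp [hx, mul_comm]
    simp_rw [this]
    rw [lintegral_indicator hs, Measure.restrict_restrict hs, lintegral_const_mul _ hu]
    have : D ∩ (s ∩ D) = s ∩ D := inter_eq_right.2 inter_subset_right
    rw [this]
    ring
  · intro f g _ hf hg ihf ihg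
    simp only [Pi.add_apply]
    simp_rw [lintegral_add_left hf, mul_add]
    rw [lintegral_add_left (mU.fun_mul (hmu hf)), ihf, ihg, lintegral_add_left (hu.fun_mul hf)]
    ring
  · intro f hf hmono ih
    simp_rw [lintegral_iSup hf hmono, ENNReal.mul_iSup]
    rw [lintegral_iSup (fun n => mU.fun_mul (hmu (hf n)))
      (fun i j hij ω => mul_le_mul_right (lintegral_mono (hmono hij)) _),
      lintegral_iSup (fun n => hu.fun_mul (hf n)) (fun i j hij ω => mul_le_mul_right (hmono hij _) _)]
    simp_rw [ih]
    rw [ENNReal.mul_iSup, ENNReal.iSup_add_iSup_of_monotone]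
    · intro i j hij
      dsimp only
      gcongr
      exact hmono hij _
    · intro i j hij
      dsimp only
      gcongr
      exact hmono hij _

lemma iSup_setLIntegral_ball (μ : Measure Plane) (u : Plane → ℝ≥0∞) :
    ⨆ n : ℕ, ∫⁻ x in Metric.ball 0 n, u x ∂μ = ∫⁻ x, u x ∂μ := by
  rw [← setLIntegral_iUnion_of_directed, Metric.iUnion_ball_nat, Measure.restrict_univ]
  exact (monotone_nat_of_le_succ fun n => Metric.ball_subset_ball (by simp)).directed_le

lemma monotone_setLIntegral_ball (μ : Measure Plane) (u : Plane → ℝ≥0∞) :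
    Monotone fun n : ℕ => ∫⁻ x in Metric.ball 0 n, u x ∂μ := fun i j hij =>
  lintegral_mono_set (Metric.ball_subset_ball (by exact_mod_cast hij))

/-- The second moments of the linear functionals of a Poisson process. -/
lemma lintegral_lintegral_mul_lintegral (h : IsPoissonPP P Φ lam)
    {u v : Plane → ℝ≥0∞} (hu : Measurable u) (hv : Measurable v) :
    ∫⁻ ω, (∫⁻ x, u x ∂Φ ω) * (∫⁻ x, v x ∂Φ ω) ∂P =
      lam * (∫⁻ x, u x) * (lam * ∫⁻ x, v x) + lam * ∫⁻ x, u x * v x := by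
  have hmu : ∀ {u : Plane → ℝ≥0∞} (n : ℕ), Measurable u →
      Measurable fun ω => ∫⁻ x in Metric.ball 0 n, u x ∂Φ ω :=
    fun n hu => h.measurable_setLIntegral Metric.isOpen_ball.measurableSet hu
  have hm := monotone_setLIntegral_ball
  have hprod : ∀ ω, (∫⁻ x, u x ∂Φ ω) * (∫⁻ x, v x ∂Φ ω) = ⨆ n : ℕ,
      (∫⁻ x in Metric.ball 0 n, u x ∂Φ ω) * (∫⁻ x in Metric.ball 0 n, v x ∂Φ ω) := by
    intro ω
    rw [← iSup_setLIntegral_ball _ u, ← iSup_setLIntegral_ball _ v,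
      ennreal_iSup_mul_iSup_of_monotone (hm _ u) (hm _ v)]
  simp_rw [hprod]
  rw [← iSup_setLIntegral_ball _ u, ← iSup_setLIntegral_ball _ v,
    ← iSup_setLIntegral_ball _ fun x => u x * v x]
  rw [lintegral_iSup (fun n => (hmu n hu).fun_mul (hmu n hv))
    (fun i j hij ω => mul_le_mul' (hm _ _ hij) (hm _ _ hij))]
  simp_rw [h.lintegral_setLIntegral_mul_setLIntegral _ Metric.isOpen_ball.measurableSet
    measure_ball_lt_top hu hv]
  rw [ENNReal.mul_iSup (lam : ℝ≥0∞), ENNReal.mul_iSup (lam : ℝ≥0∞), ENNReal.mul_iSup (lam : ℝ≥0∞),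
    ennreal_iSup_mul_iSup_of_monotone,
    ENNReal.iSup_add_iSup_of_monotone]
  · intro i j hij
    exact mul_le_mul' (mul_le_mul_right (hm _ _ hij) _) (mul_le_mul_right (hm _ _ hij) _)
  · intro i j hij
    exact mul_le_mul_right (hm _ _ hij) _
  · intro i j hij
    exact mul_le_mul_right (hm _ _ hij) _
  · intro i j hij
    exact mul_le_mul_right (hm _ _ hij) _

/-- Campbell's theorem. -/
lemma lintegral_lintegral (h : IsPoissonPP P Φ lam) {u : Plane → ℝ≥0∞} (hu : Measurable u) :
    ∫⁻ ω, ∫⁻ x, u x ∂Φ ω ∂P = lam * ∫⁻ x, u x := by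
  have hbind : ∫⁻ ω, ∫⁻ x, u x ∂Φ ω ∂P = ∫⁻ x, u x ∂(P.bind Φ) :=
    (Measure.lintegral_bind h.measurable.aemeasurable hu.aemeasurable).symm
  -- The intensity measure is a multiple of area. Exhaustion by balls is needed because the law of
  -- the counts is prescribed only for sets of finite area.
  have : P.bind Φ = (lam : ℝ≥0∞) • volume := by
    ext A hA
    rw [Measure.bind_apply hA h.measurable.aemeasurable, Measure.smul_apply, smul_eq_mul]
    have hs : ∀ μ : Measure Plane, ⨆ n : ℕ, μ (A ∩ Metric.ball 0 n) = μ A := by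
      intro μ
      have := iSup_setLIntegral_ball μ (A.indicator fun _ => 1)
      simpa only [lintegral_indicator_const hA, one_mul, Measure.restrict_apply hA] using this
    have hmono : ∀ μ : Measure Plane, Monotone fun n : ℕ => μ (A ∩ Metric.ball 0 n) :=
      fun μ i j hij => measure_mono
        (inter_subset_inter_right _ (Metric.ball_subset_ball (by exact_mod_cast hij)))
    simp_rw [← hs (Φ _)]
    rw [← hs volume, lintegral_iSup
      (fun n => h.measurable_count (hA.inter Metric.isOpen_ball.measurableSet))
      (fun i j hij ω => hmono _ hij), ENNReal.mul_iSup]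
    exact iSup_congr fun n => h.lintegral_count (hA.inter Metric.isOpen_ball.measurableSet)
      ((measure_mono inter_subset_right).trans_lt measure_ball_lt_top)
  rw [hbind, this, lintegral_smul_measure, smul_eq_mul]

end IsPoissonPP

end PoissonProcess

/-! ### Tonelli's theorem for independent variables. -/

section Independence

variable {Ω α β : Type*} [MeasurableSpace Ω] [MeasurableSpace α] [MeasurableSpace β]
  {P : Measure Ω} [IsProbabilityMeasure P] {X : Ω → α} {Y : Ω → β}

/-- The joint law is the product of the marginals; a second copy of Ω serves as the independent copy
of Y. -/
lemma ProbabilityTheory.IndepFun.lintegral_eq_lintegral_lintegral (h : IndepFun X Y P)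
    (hX : Measurable X) (hY : Measurable Y) {F : α × β → ℝ≥0∞} (hF : Measurable F) :
    ∫⁻ ω, F (X ω, Y ω) ∂P = ∫⁻ ω, ∫⁻ ω', F (X ω, Y ω') ∂P ∂P := by
  have : SFinite (P.map Y) := inferInstance
  rw [← lintegral_map (f := F) hF (hX.prodMk hY),
    (indepFun_iff_map_prod_eq_prod_map_map hX.aemeasurable hY.aemeasurable).1 h,
    lintegral_prod _ hF.aemeasurable, lintegral_map hF.lintegral_prod_right' hX]
  exact lintegral_congr fun ω => lintegral_map (hF.comp measurable_prodMk_left) hY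

end Independence

/-! ### Moments of a single cluster with a given parent. -/

section Cluster

/-- The number of offspring in `A` of a parent at `z`, for the cluster size and displacements `y`. -/
noncomputable def clusterCount (A : Set Plane) (z : Plane) (y : ℕ × (ℕ → Plane)) : ℝ≥0∞ :=
  ∑ j ∈ Finset.range y.1, A.indicator 1 (z + y.2 j)

/-- The probability that an offspring of a parent at `z` lies in `A`. -/
noncomputable def offspringProb (f : Plane → ℝ≥0) (A : Set Plane) (z : Plane) : ℝ≥0∞ :=
  ∫⁻ x in A, f (x - z)

lemma measurable_clusterCount {A : Set Plane} (hA : MeasurableSet A) :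
    Measurable fun p : Plane × ℕ × (ℕ → Plane) => clusterCount A p.1 p.2 := by
  have h1 : Measurable fun q : (Plane × (ℕ → Plane)) × ℕ => clusterCount A q.1.1 (q.2, q.1.2) := by
    refine measurable_from_prod_countable_left fun n => ?_
    dsimp only [clusterCount]
    have hj : ∀ j, Measurable fun q : Plane × (ℕ → Plane) =>
        A.indicator (1 : Plane → ℝ≥0∞) (q.1 + q.2 j) := fun j => by
      have hq : Measurable fun q : Plane × (ℕ → Plane) => q.1 + q.2 j := by fun_prop
      exact (measurable_one.indicator hA).comp hq
    exact Finset.measurable_fun_sum _ fun j _ => hj j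
  exact h1.comp (by fun_prop : Measurable fun p : Plane × ℕ × (ℕ → Plane) => ((p.1, p.2.2), p.2.1))

lemma Measurable.clusterCount {α : Type*} [MeasurableSpace α] {A : Set Plane}
    (hA : MeasurableSet A) {z : α → Plane} {y : α → ℕ × (ℕ → Plane)} (hz : Measurable z)
    (hy : Measurable y) : Measurable fun a => clusterCount A (z a) (y a) := by
  have h := (measurable_clusterCount hA).comp (hz.prodMk hy)
  simpa only [Function.comp_def] using h

lemma measurable_offspringProb {f : Plane → ℝ≥0} (hf : Measurable f) (A : Set Plane) :
    Measurable (offspringProb f A) := by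
  unfold offspringProb
  exact Measurable.lintegral_prod_right (f := fun z x => (f (x - z) : ℝ≥0∞)) (by
    unfold Function.uncurry; fun_prop)

/-- After exchanging the integrals, each x in A contributes the total mass of z ↦ f (x - z), which
is 1. -/
lemma lintegral_offspringProb {f : Plane → ℝ≥0} (hf : Measurable f)
    (hf_one : ∫⁻ s, (f s : ℝ≥0∞) = 1) (A : Set Plane) :
    ∫⁻ z, offspringProb f A z = volume A := by
  unfold offspringProb
  rw [lintegral_lintegral_swap (by unfold Function.uncurry; fun_prop)]
  have : ∀ x : Plane, ∫⁻ z, (f (x - z) : ℝ≥0∞) = 1 := by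
    intro x
    rw [← hf_one, lintegral_sub_left_eq_self (fun z => (f z : ℝ≥0∞)) x]
  simp_rw [this]
  simp

variable {Ω : Type*} [MeasurableSpace Ω] {P : Measure Ω}
  {m : ℝ≥0} {f : Plane → ℝ≥0} {N : Ω → ℕ} {S : ℕ → Ω → Plane}

lemma lintegral_indicator_displacement {S : Ω → Plane} (hf : Measurable f)
    (hS : HasLaw S (volume.withDensity fun s => (f s : ℝ≥0∞)) P)
    {A : Set Plane} (hA : MeasurableSet A) (z : Plane) :
    ∫⁻ ω, A.indicator 1 (z + S ω) ∂P = offspringProb f A z := by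
  have hg : Measurable fun s : Plane => A.indicator (1 : Plane → ℝ≥0∞) (z + s) :=
    (measurable_one.indicator hA).comp (by fun_prop)
  rw [hS.lintegral_comp (f := fun s => A.indicator 1 (z + s)) hg.aemeasurable,
    lintegral_withDensity_eq_lintegral_mul _ (by fun_prop) hg, offspringProb,
    ← lintegral_indicator hA, ← lintegral_sub_right_eq_self _ z]
  refine lintegral_congr fun x => ?_
  simp only [Pi.mul_apply, add_sub_cancel]
  by_cases hx : x ∈ A <;> simp [hx]

variable [IsProbabilityMeasure P]

lemma lintegral_clusterCount (hf : Measurable f) (hN : Measurable N) (hS : ∀ j, Measurable (S j))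
    (hNl : HasLaw N (poissonMeasure m) P)
    (hSl : ∀ j, HasLaw (S j) (volume.withDensity fun s => (f s : ℝ≥0∞)) P)
    (hNS : IndepFun N (fun ω j => S j ω) P)
    {A : Set Plane} (hA : MeasurableSet A) (z : Plane) :
    ∫⁻ ω, clusterCount A z (N ω, fun j => S j ω) ∂P = m * offspringProb f A z := by
  rw [hNS.lintegral_eq_lintegral_lintegral (F := clusterCount A z) hN (measurable_pi_lambda _ hS)
    (Measurable.clusterCount hA measurable_const measurable_id)]
  have hg : ∀ j, Measurable fun ω => A.indicator (1 : Plane → ℝ≥0∞) (z + S j ω) := fun j =>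
    (measurable_one.indicator hA).comp ((hS j).const_add z)
  unfold clusterCount
  simp_rw [lintegral_finsetSum _ fun j _ => hg j,
    lintegral_indicator_displacement hf (hSl _) hA, Finset.sum_const, Finset.card_range,
    nsmul_eq_mul]
  rw [lintegral_mul_const _ (by fun_prop), hNl.lintegral_comp (f := fun n => (n : ℝ≥0∞))
    Measurable.of_discrete.aemeasurable, lintegral_natCast_poissonMeasure]

/-- Given the cluster size n, the double sum over offspring has n diagonal terms, where one point
lies in both sets, and n(n - 1) independent off-diagonal ones. For a Poisson size, n and n(n - 1)
have means m and m². -/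
lemma lintegral_clusterCount_mul (hf : Measurable f) (hN : Measurable N)
    (hS : ∀ j, Measurable (S j)) (hNl : HasLaw N (poissonMeasure m) P)
    (hSl : ∀ j, HasLaw (S j) (volume.withDensity fun s => (f s : ℝ≥0∞)) P)
    (hNS : IndepFun N (fun ω j => S j ω) P) (hSi : iIndepFun S P)
    {A B : Set Plane} (hA : MeasurableSet A) (hB : MeasurableSet B) (z : Plane) :
    ∫⁻ ω, clusterCount A z (N ω, fun j => S j ω) * clusterCount B z (N ω, fun j => S j ω) ∂P =
      m * offspringProb f A z * (m * offspringProb f B z) + m * offspringProb f (A ∩ B) z := by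
  have hc : ∀ {A : Set Plane}, MeasurableSet A → Measurable (clusterCount A z) := fun hA =>
    Measurable.clusterCount hA measurable_const measurable_id
  rw [hNS.lintegral_eq_lintegral_lintegral (F := fun y => clusterCount A z y * clusterCount B z y)
    hN (measurable_pi_lambda _ hS) ((hc hA).mul (hc hB))]
  have hg : ∀ {A : Set Plane}, MeasurableSet A → Measurable fun s =>
      A.indicator (1 : Plane → ℝ≥0∞) (z + s) := fun hA =>
    (measurable_one.indicator hA).comp (measurable_const_add z)
  have hpair : ∀ i j, ∫⁻ ω, A.indicator 1 (z + S i ω) * B.indicator 1 (z + S j ω) ∂P =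
      if i = j then offspringProb f (A ∩ B) z else offspringProb f A z * offspringProb f B z := by
    intro i j
    split_ifs with hij
    · rw [← hij, ← lintegral_indicator_displacement hf (hSl i) (hA.inter hB)]
      simp_rw [inter_indicator_one, Pi.mul_apply]
    · rw [← lintegral_indicator_displacement hf (hSl i) hA,
        ← lintegral_indicator_displacement hf (hSl j) hB]
      exact lintegral_mul_eq_lintegral_mul_lintegral_of_indepFun''
        ((hg hA).comp (hS i)).aemeasurable ((hg hB).comp (hS j)).aemeasurable
        ((hSi.indepFun hij).comp (hg hA) (hg hB))
  -- The truncated subtraction `n - 1` is harmless at n = 0, because of the factor n in front.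
  have hn : ∀ n : ℕ, ∫⁻ ω, clusterCount A z (n, fun j => S j ω) *
      clusterCount B z (n, fun j => S j ω) ∂P =
      n * offspringProb f (A ∩ B) z +
        n * (n - 1 : ℕ) * (offspringProb f A z * offspringProb f B z) := by
    intro n
    dsimp only [clusterCount]
    simp_rw [Finset.sum_mul_sum]
    have hm : ∀ i j, Measurable fun ω =>
        A.indicator (1 : Plane → ℝ≥0∞) (z + S i ω) * B.indicator 1 (z + S j ω) := fun i j =>
      ((hg hA).comp (hS i)).fun_mul ((hg hB).comp (hS j))
    rw [lintegral_finsetSum _ fun i _ => Finset.measurable_fun_sum _ fun j _ => hm i j]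
    simp_rw [lintegral_finsetSum _ fun j _ => hm _ j, hpair]
    have hsum : ∀ i ∈ Finset.range n, (∑ j ∈ Finset.range n, if i = j then
        offspringProb f (A ∩ B) z else offspringProb f A z * offspringProb f B z) =
        offspringProb f (A ∩ B) z +
          (n - 1 : ℕ) * (offspringProb f A z * offspringProb f B z) := by
      intro i hi
      rw [← Finset.add_sum_erase _ _ hi, if_pos rfl]
      congr 1
      rw [Finset.sum_congr rfl fun j hj => if_neg (Finset.ne_of_mem_erase hj).symm,
        Finset.sum_const, Finset.card_erase_of_mem hi, Finset.card_range, nsmul_eq_mul]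
    rw [Finset.sum_congr rfl hsum, Finset.sum_const, Finset.card_range, nsmul_eq_mul]
    ring
  simp_rw [hn]
  rw [hNl.lintegral_comp (f := fun n : ℕ => (n : ℝ≥0∞) * offspringProb f (A ∩ B) z +
        n * (n - 1 : ℕ) * (offspringProb f A z * offspringProb f B z))
    Measurable.of_discrete.aemeasurable, lintegral_add_left .of_discrete,
    lintegral_mul_const _ .of_discrete, lintegral_mul_const _ .of_discrete,
    lintegral_natCast_poissonMeasure, lintegral_natCast_mul_pred_poissonMeasure]
  ring

end Cluster

/-! ### First and second moment measures of the cluster process. -/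

section ClusterProcess

variable {Ω : Type*} [MeasurableSpace Ω] {P : Measure Ω}
  {Φ : Ω → Measure Plane} {lamP m : ℝ≥0} {f : Plane → ℝ≥0}

lemma apply_cluster_sum {N : ℕ} {z : Plane} {s : ℕ → Plane} {A : Set Plane}
    (hA : MeasurableSet A) :
    (∑ j ∈ Finset.range N, Measure.dirac (z + s j)) A = clusterCount A z (N, s) := by
  rw [Measure.finsetSum_apply, clusterCount]
  exact Finset.sum_congr rfl fun j _ => Measure.dirac_apply' _ hA

namespace IsPoissonClusterProcess

lemma measurable (h : IsPoissonClusterProcess P Φ lamP m f) : Measurable Φ := by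
  obtain ⟨Z, N, S, hZ, hN, hS, -, -, -, -, -, -, -, hΦ⟩ := h
  refine Measure.measurable_of_measurable_coe _ fun A hA => ?_
  simp_rw [hΦ, Measure.sum_apply _ hA, apply_cluster_sum hA]
  refine Measurable.tsum fun i => ?_
  exact Measurable.clusterCount hA (hZ i)
    ((hN i).prodMk (measurable_pi_lambda _ fun j => hS i j))

variable [IsProbabilityMeasure P]

/-- The intensity measure of a Poisson cluster process. -/
lemma lintegral_apply (h : IsPoissonClusterProcess P Φ lamP m f) (hf : Measurable f)
    (hf_one : ∫⁻ s, (f s : ℝ≥0∞) = 1) {A : Set Plane} (hA : MeasurableSet A) :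
    ∫⁻ ω, Φ ω A ∂P = (m * lamP : ℝ≥0) * volume A := by
  obtain ⟨Z, N, S, hZ, hN, hS, hPP, hNl, hSl, hZY, hYi, hNS, hSi, hΦ⟩ := h
  have hY : ∀ i, Measurable fun ω => (N i ω, fun j => S i j ω) := fun i =>
    (hN i).prodMk (measurable_pi_lambda _ fun j => hS i j)
  have hcl : ∀ i, Measurable fun p : (ℕ → Plane) × (ℕ → ℕ × (ℕ → Plane)) =>
      clusterCount A (p.1 i) (p.2 i) := fun i =>
    Measurable.clusterCount hA (z := fun p : (ℕ → Plane) × (ℕ → ℕ × (ℕ → Plane)) => p.1 i)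
      (y := fun p => p.2 i) ((measurable_pi_apply i).comp measurable_fst)
      ((measurable_pi_apply i).comp measurable_snd)
  simp_rw [hΦ, Measure.sum_apply _ hA, apply_cluster_sum hA]
  have key := hZY.lintegral_eq_lintegral_lintegral
    (F := fun p => ∑' i, clusterCount A (p.1 i) (p.2 i)) (measurable_pi_lambda _ hZ)
    (measurable_pi_lambda _ hY) (Measurable.tsum hcl)
  dsimp only at key
  rw [key]
  -- With the parents fixed, averaging over the clusters leaves a linear functional of the parent
  -- process, to which Campbell's theorem applies.
  have hin : ∀ ω, ∫⁻ ω', ∑' i, clusterCount A (Z i ω) (N i ω', fun j => S i j ω') ∂P =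
      ∫⁻ z, m * offspringProb f A z ∂(Measure.sum fun i => Measure.dirac (Z i ω)) := by
    intro ω
    rw [lintegral_tsum fun i => (Measurable.clusterCount hA
      measurable_const (hY i)).aemeasurable, lintegral_sum_measure]
    refine tsum_congr fun i => ?_
    rw [lintegral_clusterCount hf (hN i) (hS i) (hNl i) (hSl i) (hNS i) hA,
      lintegral_dirac' _ ((measurable_offspringProb hf A).const_mul _)]
  simp only [hin]
  rw [hPP.lintegral_lintegral ((measurable_offspringProb hf A).const_mul _),
    lintegral_const_mul _ (measurable_offspringProb hf A), lintegral_offspringProb hf hf_one]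
  push_cast
  ring

/-- The second moment measure of a Poisson cluster process. -/
lemma lintegral_apply_mul_apply (h : IsPoissonClusterProcess P Φ lamP m f) (hf : Measurable f)
    (hf_one : ∫⁻ s, (f s : ℝ≥0∞) = 1) {A B : Set Plane} (hA : MeasurableSet A)
    (hB : MeasurableSet B) :
    ∫⁻ ω, Φ ω A * Φ ω B ∂P = ∫⁻ ω, Φ ω (A ∩ B) ∂P +
      ((m * lamP : ℝ≥0) * volume A * ((m * lamP : ℝ≥0) * volume B) +
        lamP * m ^ 2 * ∫⁻ z, offspringProb f A z * offspringProb f B z) := by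
  rw [h.lintegral_apply hf hf_one (hA.inter hB)]
  obtain ⟨Z, N, S, hZ, hN, hS, hPP, hNl, hSl, hZY, hYi, hNS, hSi, hΦ⟩ := h
  have hY : ∀ i, Measurable fun ω => (N i ω, fun j => S i j ω) := fun i =>
    (hN i).prodMk (measurable_pi_lambda _ fun j => hS i j)
  have hcl : ∀ {A : Set Plane}, MeasurableSet A → ∀ i,
      Measurable fun p : (ℕ → Plane) × (ℕ → ℕ × (ℕ → Plane)) =>
      clusterCount A (p.1 i) (p.2 i) := fun hA i =>
    Measurable.clusterCount hA (z := fun p : (ℕ → Plane) × (ℕ → ℕ × (ℕ → Plane)) => p.1 i)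
      (y := fun p => p.2 i) ((measurable_pi_apply i).comp measurable_fst)
      ((measurable_pi_apply i).comp measurable_snd)
  have hclz : ∀ {A : Set Plane}, MeasurableSet A → ∀ i z,
      Measurable fun ω => clusterCount A z (N i ω, fun j => S i j ω) := fun hA i z =>
    Measurable.clusterCount hA measurable_const (hY i)
  have ma : ∀ A, Measurable (offspringProb f A) := measurable_offspringProb hf
  simp_rw [hΦ, Measure.sum_apply _ hA, Measure.sum_apply _ hB, apply_cluster_sum hA,
    apply_cluster_sum hB]
  have key := hZY.lintegral_eq_lintegral_lintegral
    (F := fun p => (∑' i, clusterCount A (p.1 i) (p.2 i)) * ∑' i, clusterCount B (p.1 i) (p.2 i))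
    (measurable_pi_lambda _ hZ) (measurable_pi_lambda _ hY)
    ((Measurable.tsum (hcl hA)).fun_mul (Measurable.tsum (hcl hB)))
  dsimp only at key
  rw [key]
  -- With the parents fixed, distinct clusters are independent, giving the product of two linear
  -- functionals of the parents; a cluster paired with itself adds only the term for A ∩ B.
  have hin : ∀ ω, ∫⁻ ω', (∑' i, clusterCount A (Z i ω) (N i ω', fun j => S i j ω')) *
        ∑' i, clusterCount B (Z i ω) (N i ω', fun j => S i j ω') ∂P =
      (∫⁻ z, m * offspringProb f A z ∂(Measure.sum fun i => Measure.dirac (Z i ω))) *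
      (∫⁻ z, m * offspringProb f B z ∂(Measure.sum fun i => Measure.dirac (Z i ω))) +
      ∫⁻ z, m * offspringProb f (A ∩ B) z ∂(Measure.sum fun i => Measure.dirac (Z i ω)) := by
    intro ω
    simp_rw [lintegral_sum_measure, lintegral_dirac' _ ((ma _).const_mul _),
      ← ENNReal.tsum_mul_right, ← ENNReal.tsum_mul_left]
    rw [← ENNReal.tsum_add, lintegral_tsum fun i => (Measurable.tsum fun j =>
      (hclz hA i _).fun_mul (hclz hB j _)).aemeasurable]
    refine tsum_congr fun i => ?_
    rw [lintegral_tsum fun j => ((hclz hA i _).fun_mul (hclz hB j _)).aemeasurable]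
    have hij : ∀ j, ∫⁻ ω', clusterCount A (Z i ω) (N i ω', fun k => S i k ω') *
        clusterCount B (Z j ω) (N j ω', fun k => S j k ω') ∂P =
        m * offspringProb f A (Z i ω) * (m * offspringProb f B (Z j ω)) +
          if j = i then m * offspringProb f (A ∩ B) (Z i ω) else 0 := by
      intro j
      split_ifs with hji
      · subst hji
        exact lintegral_clusterCount_mul hf (hN j) (hS j) (hNl j) (hSl j) (hNS j) (hSi j) hA hB _
      · rw [add_zero, ← lintegral_clusterCount hf (hN i) (hS i) (hNl i) (hSl i) (hNS i) hA,
          ← lintegral_clusterCount hf (hN j) (hS j) (hNl j) (hSl j) (hNS j) hB]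
        refine lintegral_mul_eq_lintegral_mul_lintegral_of_indepFun'' (hclz hA i _).aemeasurable
          (hclz hB j _).aemeasurable ((hYi.indepFun (Ne.symm hji)).comp
            (φ := clusterCount A (Z i ω)) (ψ := clusterCount B (Z j ω)) ?_ ?_)
        · exact Measurable.clusterCount hA measurable_const measurable_id
        · exact Measurable.clusterCount hB measurable_const measurable_id
    simp_rw [hij]
    rw [ENNReal.tsum_add, tsum_ite_eq]
  simp only [hin]
  have hmi : ∀ A, Measurable fun ω =>
      ∫⁻ z, m * offspringProb f A z ∂(Measure.sum fun i => Measure.dirac (Z i ω)) := fun A =>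
    (Measure.measurable_lintegral ((ma A).const_mul _)).comp hPP.measurable
  rw [lintegral_add_left ((hmi A).fun_mul (hmi B)),
    hPP.lintegral_lintegral_mul_lintegral ((ma A).const_mul _) ((ma B).const_mul _),
    hPP.lintegral_lintegral ((ma (A ∩ B)).const_mul _)]
  have hAB : ∀ z, (m : ℝ≥0∞) * offspringProb f A z * (m * offspringProb f B z) =
      m ^ 2 * (offspringProb f A z * offspringProb f B z) := fun z => by ring
  simp_rw [hAB]
  rw [lintegral_const_mul _ (ma _), lintegral_const_mul _ (ma _), lintegral_const_mul _ (ma _),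
    lintegral_const_mul _ ((ma _).fun_mul (ma _)), lintegral_offspringProb hf hf_one,
    lintegral_offspringProb hf hf_one, lintegral_offspringProb hf hf_one]
  push_cast
  ring

end IsPoissonClusterProcess

end ClusterProcess

/-! ### The Voronoi cell described by countably many masses. -/

section BallBase

open Filter Topology TopologicalSpace

/-- A countable base of the topology of the plane: balls about the points of a dense sequence. -/
noncomputable def baseBall (p : ℕ × ℕ) : Set Plane :=
  Metric.ball (denseSeq Plane p.1) (1 / ((p.2 : ℝ) + 1))

lemma measurableSet_baseBall (p : ℕ × ℕ) : MeasurableSet (baseBall p) :=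
  Metric.isOpen_ball.measurableSet

lemma exists_mem_baseBall (x : Plane) (n : ℕ) : ∃ k, x ∈ baseBall (k, n) := by
  obtain ⟨k, hk⟩ := (denseRange_denseSeq Plane).exists_dist_lt x
    (ε := 1 / ((n : ℝ) + 1)) (by positivity)
  exact ⟨k, hk⟩

/-- A sufficient condition for `baseBall p ⊆ ball y r`. -/
def BaseBallInside (p : ℕ × ℕ) (y : Plane) (r : ℝ) : Prop :=
  dist (denseSeq Plane p.1) y + 1 / ((p.2 : ℝ) + 1) ≤ r

lemma BaseBallInside.subset {p : ℕ × ℕ} {y : Plane} {r : ℝ} (h : BaseBallInside p y r) :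
    baseBall p ⊆ Metric.ball y r :=
  Metric.ball_subset_ball' (by unfold BaseBallInside at h; linarith)

lemma ball_eq_iUnion_baseBall (y : Plane) (r : ℝ) :
    Metric.ball y r = ⋃ p, ⋃ (_ : BaseBallInside p y r), baseBall p := by
  refine Subset.antisymm (fun x hx => ?_) (iUnion₂_subset fun p hp => hp.subset)
  obtain ⟨n, hn⟩ := exists_nat_one_div_lt (half_pos (sub_pos.2 (Metric.mem_ball.1 hx)))
  obtain ⟨k, hk⟩ := exists_mem_baseBall x n
  refine mem_iUnion₂.2 ⟨(k, n), ?_, hk⟩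
  have hk' : dist x (denseSeq Plane k) < 1 / ((n : ℝ) + 1) := hk
  have := dist_triangle_left (denseSeq Plane k) y x
  unfold BaseBallInside
  dsimp only
  linarith

/-- This separates the variables: each condition on the right combines a closed condition on y and r
with the vanishing of φ on a fixed set. Joint measurability of the cell in φ and y follows. -/
lemma measure_ball_eq_zero_iff (φ : Measure Plane) (y : Plane) (r : ℝ) :
    φ (Metric.ball y r) = 0 ↔ ∀ p, BaseBallInside p y r → φ (baseBall p) = 0 := by
  rw [ball_eq_iUnion_baseBall]
  simp only [measure_iUnion_null_iff]

/-- The points of the plane that are not closer to a point of `φ` than to the origin,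
up to a null set of points of `φ`. -/
def emptyRegion (φ : Measure Plane) : Set Plane := {y | φ (Metric.ball y ‖y‖) = 0}

lemma measurableSet_mem_emptyRegion :
    MeasurableSet {p : Measure Plane × Plane | p.2 ∈ emptyRegion p.1} := by
  have : {p : Measure Plane × Plane | p.2 ∈ emptyRegion p.1} =
      ⋂ q : ℕ × ℕ, {p : Measure Plane × Plane | BaseBallInside q p.2 ‖p.2‖}ᶜ ∪
        {p : Measure Plane × Plane | p.1 (baseBall q) = 0} := by
    ext p
    simp only [emptyRegion, mem_ofPred_eq, measure_ball_eq_zero_iff, mem_iInter, mem_union,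
      mem_compl_iff, imp_iff_not_or]
  rw [this]
  refine MeasurableSet.iInter fun q => MeasurableSet.union (MeasurableSet.compl ?_) ?_
  · exact measurableSet_le (by fun_prop) (by fun_prop)
  · exact ((Measure.measurable_coe (measurableSet_baseBall q)).comp measurable_fst)
      (measurableSet_singleton 0)

lemma measurableSet_emptyRegion (φ : Measure Plane) : MeasurableSet (emptyRegion φ) :=
  measurableSet_mem_emptyRegion.preimage (measurable_prodMk_left (x := φ))

/-- A finite intersection of balls of the countable base. -/
noncomputable def baseInter (p : ℕ × ℕ) (s : Finset (ℕ × ℕ)) : Set Plane :=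
  baseBall p ∩ ⋂ q ∈ s, baseBall q

lemma measurableSet_baseInter (p : ℕ × ℕ) (s : Finset (ℕ × ℕ)) :
    MeasurableSet (baseInter p s) :=
  (measurableSet_baseBall p).inter (s.measurableSet_biInter fun q _ => measurableSet_baseBall q)

/-- The measures with integer values on the finite intersections of balls of the base. -/
def integerOnBase : Set (Measure Plane) :=
  {φ | ∀ p s, ∃ n : ℕ, φ (baseInter p s) = n}

lemma measurableSet_integerOnBase : MeasurableSet integerOnBase := by
  have : integerOnBase = ⋂ (p) (s), ⋃ n : ℕ, {φ : Measure Plane | φ (baseInter p s) = n} := by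
    ext φ
    simp [integerOnBase]
  rw [this]
  exact MeasurableSet.iInter fun p => MeasurableSet.iInter fun s => MeasurableSet.iUnion fun n =>
    (Measure.measurable_coe (measurableSet_baseInter p s)) (measurableSet_singleton _)

/-- Intersect repeatedly with ever smaller base balls, keeping the mass nonzero. Integrality keeps
it at least 1, so by continuity from above the limit set has mass at least 1; its diameter is 0, so
it is an atom. -/
lemma exists_atom_of_mem_integerOnBase {φ : Measure Plane} (hφ : φ ∈ integerOnBase) {p : ℕ × ℕ}
    (hp : φ (baseBall p) ≠ 0) : ∃ t ∈ baseBall p, φ {t} ≠ 0 := by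
  have hstep : ∀ (s : Finset (ℕ × ℕ)) (n : ℕ), φ (baseInter p s) ≠ 0 →
      ∃ k, φ (baseInter p (insert (k, n) s)) ≠ 0 := by
    intro s n hs
    by_contra! h
    refine hs (measure_mono_null ?_ (measure_iUnion_null h))
    intro x hx
    obtain ⟨k, hk⟩ := exists_mem_baseBall x n
    refine mem_iUnion.2 ⟨k, hx.1, ?_⟩
    rw [Finset.set_biInter_insert]
    exact ⟨hk, hx.2⟩
  choose! k hk using hstep
  let s : ℕ → Finset (ℕ × ℕ) := fun n => Nat.rec ∅ (fun n s => insert (k s n, n) s) n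
  have hs : ∀ n, s (n + 1) = insert (k (s n) n, n) (s n) := fun n => rfl
  have hpos : ∀ n, φ (baseInter p (s n)) ≠ 0 := by
    intro n
    induction n with
    | zero => simpa [s, baseInter] using hp
    | succ n ih => rw [hs]; exact hk _ n ih
  have hge : ∀ n, 1 ≤ φ (baseInter p (s n)) := by
    intro n
    obtain ⟨j, hj⟩ := hφ p (s n)
    have := hpos n
    rw [hj] at this ⊢
    exact_mod_cast Nat.one_le_iff_ne_zero.2 (by exact_mod_cast this)
  have hanti : Antitone fun n => baseInter p (s n) := by
    refine antitone_nat_of_succ_le fun n => ?_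
    rw [hs]
    exact inter_subset_inter_right _ (biInter_subset_biInter_left (by simp))
  have hlim := tendsto_measure_iInter_atTop (μ := φ)
    (fun n => (measurableSet_baseInter p (s n)).nullMeasurableSet) hanti
    ⟨0, by obtain ⟨j, hj⟩ := hφ p (s 0); rw [hj]; exact ENNReal.natCast_ne_top j⟩
  have hone : 1 ≤ φ (⋂ n, baseInter p (s n)) := ge_of_tendsto' hlim hge
  obtain ⟨t, ht⟩ := nonempty_of_measure_ne_zero (one_pos.trans_le hone).ne'
  have hmem : ∀ {x}, x ∈ ⋂ n, baseInter p (s n) → ∀ n, x ∈ baseBall (k (s n) n, n) := by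
    intro x hx n
    have := (mem_iInter.1 hx (n + 1)).2
    rw [hs, Finset.set_biInter_insert] at this
    exact this.1
  have hsub : ⋂ n, baseInter p (s n) ⊆ {t} := by
    intro x hx
    rw [mem_singleton_iff, ← dist_le_zero]
    refine le_of_forall_pos_lt_add fun ε hε => ?_
    obtain ⟨n, hn⟩ := exists_nat_one_div_lt (half_pos hε)
    have h1 := Metric.mem_ball.1 (hmem hx n)
    have h2 := Metric.mem_ball.1 (hmem ht n)
    have := dist_triangle_right x t (denseSeq Plane (k (s n) n))
    dsimp only at h1 h2
    linarith
  exact ⟨t, (mem_iInter.1 ht 0).1, (one_pos.trans_le (hone.trans (measure_mono hsub))).ne'⟩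

/-- A point strictly closer to y than the origin is an atom in the open disc about y through the
origin. Integrality is needed to find such an atom when that disc has positive mass. -/
lemma voronoiCell_zero_eq_emptyRegion {φ : Measure Plane} (hφ : φ ∈ integerOnBase) :
    voronoiCell φ 0 = emptyRegion φ := by
  ext y
  simp only [voronoiCell, emptyRegion, mem_ofPred_eq, sub_zero]
  constructor
  · intro h
    rw [measure_ball_eq_zero_iff]
    intro p hp
    by_contra hne
    obtain ⟨t, ht, hφt⟩ := exists_atom_of_mem_integerOnBase hφ hne
    have := hp.subset ht
    rw [Metric.mem_ball', dist_eq_norm] at this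
    exact absurd (h t hφt) (not_le.2 this)
  · intro h t ht
    by_contra! hlt
    refine ht (measure_mono_null (singleton_subset_iff.2 ?_) h)
    rwa [Metric.mem_ball', dist_eq_norm]

end BallBase

/-! ### Void probabilities of the Palm version. -/

section Palm

open Filter Topology TopologicalSpace

variable {Ω' : Type*} [MeasurableSpace Ω'] {P' : Measure Ω'}
  {Ω : Type*} [MeasurableSpace Ω] {P : Measure Ω}
  {Φ : Ω' → Measure Plane} {lam : ℝ≥0} {Φ₀ : Ω → Measure Plane}

/-- Almost surely every translate of Φ has integer counts on bounded sets, so the Palm identity for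
the exceptional event has right side 0, while the factor λ|B| is positive. -/
lemma HasPalmLaw.ae_mem_integerOnBase (h : HasPalmLaw P' Φ lam P Φ₀) (hΦ : IsPointProcess P' Φ)
    (hlam : 0 < lam) : ∀ᵐ ω ∂P, Φ₀ ω ∈ integerOnBase := by
  have hp := h.palm (Metric.ball 0 1) integerOnBaseᶜ Metric.isOpen_ball.measurableSet
    measurableSet_integerOnBase.compl
  have hzero : ∫⁻ ω, Φ ω {x | x ∈ Metric.ball 0 1 ∧
      (Φ ω).map (fun t => t - x) ∈ integerOnBaseᶜ} ∂P' = 0 := by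
    rw [lintegral_eq_zero_of_ae_eq_zero]
    filter_upwards [hΦ.counting] with ω hω
    have : {x | x ∈ Metric.ball (0 : Plane) 1 ∧
        (Φ ω).map (fun t => t - x) ∈ integerOnBaseᶜ} = ∅ := by
      refine eq_empty_of_forall_notMem fun x hx => hx.2 fun p s => ?_
      have hm : Measurable fun t : Plane => t - x := by fun_prop
      rw [Measure.map_apply hm (measurableSet_baseInter p s)]
      refine hω _ (hm (measurableSet_baseInter p s)) ?_
      refine (Metric.isBounded_ball (x := denseSeq Plane p.1 + x)
        (r := 1 / ((p.2 : ℝ) + 1))).subset fun t ht => ?_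
      have ht' := Metric.mem_ball.1 (ht.1 : t - x ∈ baseBall p)
      rwa [dist_eq_norm, sub_sub, add_comm x, ← dist_eq_norm] at ht'
    rw [this, measure_empty, Pi.zero_apply]
  rw [hzero, mul_eq_zero, mul_eq_zero] at hp
  rcases hp with (hp | hp) | hp
  · exact absurd (by exact_mod_cast hp) hlam.ne'
  · exact absurd hp (Metric.measure_ball_pos volume 0 one_pos).ne'
  · exact hp

lemma IsPoissonPP.lintegral_count_mul_indicator (h : IsPoissonPP P' Φ lam) {A B : Set Plane}
    (hA : MeasurableSet A) (hB : MeasurableSet B) (hAB : Disjoint A B) (hAv : volume A < ∞)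
    (hBv : volume B < ∞) :
    ∫⁻ ω, Φ ω A * ({0} : Set ℝ≥0∞).indicator 1 (Φ ω B) ∂P' =
      lam * volume A * ENNReal.ofReal (Real.exp (-(lam * volume.real B))) := by
  have hi : Measurable (({0} : Set ℝ≥0∞).indicator (1 : ℝ≥0∞ → ℝ≥0∞)) :=
    measurable_one.indicator (measurableSet_singleton 0)
  have hI : IndepFun (fun ω => Φ ω A) (fun ω => ({0} : Set ℝ≥0∞).indicator 1 (Φ ω B)) P' :=
    (h.indepFun_count hA hB hAB).comp measurable_id hi
  rw [lintegral_mul_eq_lintegral_mul_lintegral_of_indepFun''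
    (h.measurable_count hA).aemeasurable (hi.fun_comp (h.measurable_count hB)).aemeasurable hI,
    h.lintegral_count hA hAv,
    ← h.measure_count_eq_zero hB hBv]
  congr 1
  exact lintegral_indicator_one (s := {ω | Φ ω B = 0})
    (h.measurable_count hB (measurableSet_singleton 0))

/-- The index of the first ball of radius `1 / (n + 1)` of the base that contains a point. -/
noncomputable def cellIndex (n : ℕ) (x : Plane) : ℕ :=
  open Classical in Nat.find (exists_mem_baseBall x n)

lemma mem_baseBall_cellIndex (n : ℕ) (x : Plane) : x ∈ baseBall (cellIndex n x, n) := by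
  classical exact Nat.find_spec (exists_mem_baseBall x n)

lemma measurable_cellIndex (n : ℕ) : Measurable (cellIndex n) := by
  classical exact measurable_find _ fun k => measurableSet_baseBall (k, n)

/-- The points of `U` at distance at least `1 / (n + 1)` from the complement of `U`. -/
def innerPart (U : Set Plane) (n : ℕ) : Set Plane := (Metric.thickening (1 / ((n : ℝ) + 1)) Uᶜ)ᶜ

lemma measurableSet_innerPart (U : Set Plane) (n : ℕ) : MeasurableSet (innerPart U n) :=
  Metric.isOpen_thickening.measurableSet.compl

lemma mem_of_mem_innerPart {U : Set Plane} {n : ℕ} {t s : Plane} (ht : t ∈ innerPart U n)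
    (hs : dist t s < 1 / ((n : ℝ) + 1)) : s ∈ U := by
  by_contra h
  exact ht (Metric.mem_thickening_iff.2 ⟨s, h, hs⟩)

lemma innerPart_subset (U : Set Plane) (n : ℕ) : innerPart U n ⊆ U := fun t ht =>
  mem_of_mem_innerPart ht (by rw [dist_self]; positivity)

/-- The uniform radius δ leaves room for replacing a translation by x with one by the centre of a
nearby ball. -/
lemma eventually_mem_innerPart {U : Set Plane} (hU : IsOpen U) {t : Plane} (ht : t ∈ U) :
    ∃ δ > 0, ∀ᶠ n in atTop, ∀ s, dist s t < δ → s ∈ innerPart U n := by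
  obtain ⟨ε, hε, hb⟩ := Metric.isOpen_iff.1 hU t ht
  refine ⟨ε / 2, half_pos hε, ?_⟩
  have := tendsto_one_div_add_atTop_nhds_zero_nat (𝕜 := ℝ)
  filter_upwards [this.eventually_lt_const (half_pos hε)] with n hn s hs hmem
  obtain ⟨z, hz, hsz⟩ := Metric.mem_thickening_iff.1 hmem
  refine hz (hb ?_)
  rw [Metric.mem_ball]
  have := dist_triangle_left z t s
  linarith

lemma monotone_innerPart (U : Set Plane) : Monotone (innerPart U) := fun i j hij =>
  compl_subset_compl.2 (Metric.thickening_mono (by gcongr) _)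

lemma iUnion_innerPart {U : Set Plane} (hU : IsOpen U) : ⋃ n, innerPart U n = U := by
  refine Subset.antisymm (iUnion_subset (innerPart_subset U)) fun t ht => ?_
  obtain ⟨δ, hδ, h⟩ := eventually_mem_innerPart hU ht
  obtain ⟨n, hn⟩ := h.exists
  exact mem_iUnion.2 ⟨n, hn t (by rwa [dist_self])⟩

/-- The translate of `innerPart U n` by the centre of the `k`-th ball of radius `1 / (n + 1)`. -/
def innerTranslate (U : Set Plane) (n k : ℕ) : Set Plane :=
  (fun t => t - denseSeq Plane k) ⁻¹' innerPart U n

lemma measurableSet_innerTranslate (U : Set Plane) (n k : ℕ) :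
    MeasurableSet (innerTranslate U n k) :=
  (measurableSet_innerPart U n).preimage (by fun_prop)

lemma volume_innerTranslate (U : Set Plane) (n k : ℕ) :
    volume (innerTranslate U n k) = volume (innerPart U n) :=
  (measurePreserving_sub_right volume (denseSeq Plane k)).measure_preimage
    (measurableSet_innerPart U n).nullMeasurableSet

/-- The points `x` of `B` whose translate of `U`, approximated from inside, has no mass. -/
def voidApprox (φ : Measure Plane) (B U : Set Plane) (n : ℕ) : Set Plane :=
  {x | x ∈ B ∧ φ (innerTranslate U n (cellIndex n x)) = 0}

lemma voidApprox_eq_iUnion (φ : Measure Plane) (B U : Set Plane) (n : ℕ) :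
    voidApprox φ B U n = ⋃ k, {x | (x ∈ B ∩ cellIndex n ⁻¹' {k}) ∧
      φ (innerTranslate U n k) = 0} := by
  ext x
  simp only [voidApprox, mem_ofPred_eq, mem_iUnion, mem_inter_iff, mem_preimage, mem_singleton_iff]
  constructor
  · rintro ⟨h1, h2⟩
    exact ⟨_, ⟨h1, rfl⟩, h2⟩
  · rintro ⟨k, ⟨h1, rfl⟩, h2⟩
    exact ⟨h1, h2⟩

lemma measurableSet_cell {B : Set Plane} (hB : MeasurableSet B) (n k : ℕ) :
    MeasurableSet (B ∩ cellIndex n ⁻¹' {k}) :=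
  hB.inter (measurable_cellIndex n (measurableSet_singleton k))

lemma measurableSet_voidApprox (φ : Measure Plane) {B : Set Plane} (hB : MeasurableSet B)
    (U : Set Plane) (n : ℕ) : MeasurableSet (voidApprox φ B U n) := by
  rw [voidApprox_eq_iUnion]
  exact MeasurableSet.iUnion fun k => (measurableSet_cell hB n k).inter (MeasurableSet.const _)

lemma pairwise_disjoint_cell (B : Set Plane) (n : ℕ) :
    Pairwise (Function.onFun Disjoint fun k => B ∩ cellIndex n ⁻¹' {k}) := fun _ _ hij =>
  ((disjoint_singleton.2 hij).preimage _).mono inter_subset_right inter_subset_right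

/-- On one cell the tested translate does not depend on x, so the void condition becomes a constant
factor there. -/
lemma measure_voidApprox (φ : Measure Plane) {B : Set Plane} (hB : MeasurableSet B)
    (U : Set Plane) (n : ℕ) :
    φ (voidApprox φ B U n) = ∑' k, φ (B ∩ cellIndex n ⁻¹' {k}) *
      ({0} : Set ℝ≥0∞).indicator 1 (φ (innerTranslate U n k)) := by
  rw [voidApprox_eq_iUnion, measure_iUnion]
  · refine tsum_congr fun k => ?_
    by_cases h : φ (innerTranslate U n k) = 0 <;> simp [h, inter_def]
  · intro _ _ hij
    exact (pairwise_disjoint_cell B n hij).mono (fun x hx => hx.1) (fun x hx => hx.1)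
  · exact fun k => (measurableSet_cell hB n k).inter (MeasurableSet.const _)

lemma IsPoissonPP.lintegral_voidApprox (h : IsPoissonPP P' Φ lam) {B U : Set Plane}
    (hB : MeasurableSet B) (hBv : volume B < ∞) (hUv : volume U < ∞) (hU0 : (0 : Plane) ∉ U)
    (n : ℕ) :
    ∫⁻ ω, Φ ω (voidApprox (Φ ω) B U n) ∂P' =
      lam * volume B * ENNReal.ofReal (Real.exp (-(lam * volume.real (innerPart U n)))) := by
  have hi : Measurable (({0} : Set ℝ≥0∞).indicator (1 : ℝ≥0∞ → ℝ≥0∞)) :=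
    measurable_one.indicator (measurableSet_singleton 0)
  simp_rw [measure_voidApprox _ hB]
  rw [lintegral_tsum fun k => ((h.measurable_count (measurableSet_cell hB n k)).fun_mul
    (hi.fun_comp (h.measurable_count (measurableSet_innerTranslate U n k)))).aemeasurable]
  have hk : ∀ k, ∫⁻ ω, Φ ω (B ∩ cellIndex n ⁻¹' {k}) *
      ({0} : Set ℝ≥0∞).indicator 1 (Φ ω (innerTranslate U n k)) ∂P' =
      lam * volume (B ∩ cellIndex n ⁻¹' {k}) *
        ENNReal.ofReal (Real.exp (-(lam * volume.real (innerPart U n)))) := by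
    intro k
    rw [h.lintegral_count_mul_indicator (measurableSet_cell hB n k)
      (measurableSet_innerTranslate U n k) ?_ ((measure_mono inter_subset_left).trans_lt hBv) ?_,
      Measure.real, Measure.real, volume_innerTranslate]
    -- A point x of the cell is within 1/(n + 1) of the centre. If it were in the inner translate, x
    -- minus the centre would be a point of the inner part that close to 0, forcing 0 ∈ U.
    · rw [Set.disjoint_left]
      rintro x ⟨-, rfl⟩ hx
      refine hU0 (mem_of_mem_innerPart hx ?_)
      have := Metric.mem_ball.1 (mem_baseBall_cellIndex n x)
      rwa [dist_zero_right, ← dist_eq_norm]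
    · rw [volume_innerTranslate]
      exact (measure_mono (innerPart_subset U n)).trans_lt hUv
  simp_rw [hk]
  rw [ENNReal.tsum_mul_right, ENNReal.tsum_mul_left,
    ← measure_iUnion (pairwise_disjoint_cell B n) (measurableSet_cell hB n), ← inter_iUnion]
  congr 3
  rw [inter_eq_left, ← preimage_iUnion]
  intro x _
  simp

/-- The inner translates lie inside x + U, so they are null whenever x + U is. Conversely, any
infinite family of them covers x + U, so if x + U has mass then only finitely many can be null. -/
lemma eventually_mem_voidApprox_iff (φ : Measure Plane) (B : Set Plane) {U : Set Plane}
    (hU : IsOpen U) (x : Plane) :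
    ∀ᶠ n in atTop, x ∈ voidApprox φ B U n ↔
      x ∈ B ∧ φ.map (fun t => t - x) ∈ {φ : Measure Plane | φ U = 0} := by
  have hm : Measurable fun t : Plane => t - x := by fun_prop
  simp only [mem_ofPred_eq, Measure.map_apply hm hU.measurableSet]
  have hdist : ∀ n, dist x (denseSeq Plane (cellIndex n x)) < 1 / ((n : ℝ) + 1) := fun n =>
    Metric.mem_ball.1 (mem_baseBall_cellIndex n x)
  have hsub : ∀ n, innerTranslate U n (cellIndex n x) ⊆ (fun t => t - x) ⁻¹' U := by
    intro n t ht
    refine mem_of_mem_innerPart (U := U) ht ?_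
    rw [dist_sub_left, dist_comm]
    exact hdist n
  by_cases h0 : φ ((fun t => t - x) ⁻¹' U) = 0
  · exact Eventually.of_forall fun n => and_congr_right fun _ =>
      iff_of_true (measure_mono_null (hsub n) h0) h0
  · have : ∀ᶠ n in atTop, φ (innerTranslate U n (cellIndex n x)) ≠ 0 := by
      by_contra hfreq
      rw [not_eventually] at hfreq
      simp only [not_not] at hfreq
      refine h0 (measure_mono_null ?_ (measure_biUnion_null_iff (to_countable
        {n | φ (innerTranslate U n (cellIndex n x)) = 0}) |>.2 fun n hn => hn))
      intro t ht
      obtain ⟨δ, hδ, hev⟩ := eventually_mem_innerPart hU ht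
      have hlim := tendsto_one_div_add_atTop_nhds_zero_nat (𝕜 := ℝ)
      obtain ⟨n, hn, hn1, hn2⟩ :=
        (hfreq.and_eventually (hev.and (hlim.eventually_lt_const hδ))).exists
      refine mem_iUnion₂.2 ⟨n, hn, hn1 _ ?_⟩
      rw [dist_sub_left, dist_comm]
      exact (hdist n).trans hn2
    filter_upwards [this] with n hn
    exact and_congr_right fun _ => iff_of_false hn h0

/-- The void probabilities of a Poisson process seen from its typical point. -/
lemma HasPalmLaw.measure_void (h : HasPalmLaw P' Φ lam P Φ₀) (hΦ : IsPoissonPP P' Φ lam)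
    (hlam : 0 < lam) {U : Set Plane} (hU : IsOpen U) (hUv : volume U < ∞)
    (hU0 : (0 : Plane) ∉ U) :
    P {ω | Φ₀ ω U = 0} = ENNReal.ofReal (Real.exp (-(lam * volume.real U))) := by
  set B : Set Plane := Metric.ball 0 1
  have hB : MeasurableSet B := Metric.isOpen_ball.measurableSet
  have hBv : volume B < ∞ := measure_ball_lt_top
  have hlamB : (lam : ℝ≥0∞) * volume B ≠ 0 :=
    mul_ne_zero (by exact_mod_cast hlam.ne') (Metric.measure_ball_pos volume 0 one_pos).ne'
  have hlamB' : (lam : ℝ≥0∞) * volume B ≠ ∞ := ENNReal.mul_ne_top ENNReal.coe_ne_top hBv.ne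
  have hint := hΦ.lintegral_count hB hBv
  have hF : MeasurableSet {φ : Measure Plane | φ U = 0} :=
    Measure.measurable_coe hU.measurableSet (measurableSet_singleton 0)
  have hp := h.palm B _ hB hF
  -- The count in B dominates and has finite mean. Dominated convergence is used twice: for φ on
  -- subsets of B with ω fixed, then in ω.
  have hlim1 : Tendsto (fun n => ∫⁻ ω, Φ ω (voidApprox (Φ ω) B U n) ∂P') atTop
      (𝓝 (∫⁻ ω, Φ ω {x | x ∈ B ∧ (Φ ω).map (fun t => t - x) ∈ {φ : Measure Plane | φ U = 0}}
        ∂P')) := by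
    refine tendsto_lintegral_of_dominated_convergence (fun ω => Φ ω B) (fun n => ?_)
      (fun n => ae_of_all _ fun ω => measure_mono fun x hx => hx.1) (by rwa [hint]) ?_
    · simp_rw [measure_voidApprox _ hB]
      refine Measurable.tsum fun k => (hΦ.measurable_count (measurableSet_cell hB n k)).fun_mul ?_
      exact (measurable_one.indicator (measurableSet_singleton 0)).comp
        (hΦ.measurable_count (measurableSet_innerTranslate U n k))
    · filter_upwards [ae_lt_top (hΦ.measurable_count hB) (by rwa [hint])] with ω hω
      refine tendsto_measure_of_tendsto_indicator atTop
        (fun n => measurableSet_voidApprox _ hB U n) hB hω.ne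
        (Eventually.of_forall fun n x hx => hx.1) ?_
      exact fun x => eventually_mem_voidApprox_iff (Φ ω) B hU x
  simp_rw [hΦ.lintegral_voidApprox hB hBv hUv hU0] at hlim1
  rw [← hp] at hlim1
  have hvol : Tendsto (fun n => volume.real (innerPart U n)) atTop (𝓝 (volume.real U)) := by
    refine (ENNReal.tendsto_toReal hUv.ne).comp ?_
    have := tendsto_measure_iUnion_atTop (μ := volume) (monotone_innerPart U)
    rwa [iUnion_innerPart hU] at this
  have hlim2 : Tendsto (fun n => (lam : ℝ≥0∞) * volume B *
      ENNReal.ofReal (Real.exp (-(lam * volume.real (innerPart U n))))) atTop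
      (𝓝 (lam * volume B * ENNReal.ofReal (Real.exp (-(lam * volume.real U))))) :=
    ENNReal.Tendsto.const_mul (ENNReal.tendsto_ofReal ((Real.continuous_exp.tendsto _).comp
      (hvol.const_mul (lam : ℝ)).neg)) (Or.inr hlamB')
  exact (ENNReal.mul_right_inj hlamB hlamB').1 (tendsto_nhds_unique hlim1 hlim2)

/-- Both points belong to the region exactly when the union of their discs is empty. Each disc omits
the origin, as its radius is the distance of its centre from the origin. -/
lemma HasPalmLaw.measure_mem_emptyRegion (h : HasPalmLaw P' Φ lam P Φ₀)
    (hΦ : IsPoissonPP P' Φ lam) (hlam : 0 < lam) (x y : Plane) :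
    P {ω | x ∈ emptyRegion (Φ₀ ω) ∧ y ∈ emptyRegion (Φ₀ ω)} =
      ENNReal.ofReal (Real.exp (-(lam *
        volume.real (Metric.ball x ‖x‖ ∪ Metric.ball y ‖y‖)))) := by
  rw [← h.measure_void hΦ hlam (Metric.isOpen_ball.union Metric.isOpen_ball)
    ((measure_union_le _ _).trans_lt (ENNReal.add_lt_top.2
      ⟨measure_ball_lt_top, measure_ball_lt_top⟩)) (by simp)]
  simp only [emptyRegion, mem_ofPred_eq, measure_union_null_iff]

end Palm

/-! ### The second moment density for isotropic displacements. -/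

section IsotropicDensity

/-- The density at `x` of the difference of two independent displacements. -/
noncomputable def overlap (f : Plane → ℝ≥0) (x : Plane) : ℝ≥0∞ :=
  ∫⁻ z : Plane, (f z : ℝ≥0∞) * (f (z + x) : ℝ≥0∞)

lemma measurable_overlap {f : Plane → ℝ≥0} (hf : Measurable f) : Measurable (overlap f) := by
  unfold overlap
  exact Measurable.lintegral_prod_right
    (f := fun x z : Plane => (f z : ℝ≥0∞) * (f (z + x) : ℝ≥0∞)) (by
      unfold Function.uncurry; fun_prop)

lemma overlap_eq_of_norm_eq {f : Plane → ℝ≥0} (hf : Measurable f)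
    (hiso : ∀ x y : Plane, ‖x‖ = ‖y‖ → f x = f y) {x y : Plane} (hxy : ‖x‖ = ‖y‖) :
    overlap f x = overlap f y := by
  obtain ⟨O, hO⟩ := exists_isometry_map_eq hxy
  unfold overlap
  have hm : Measurable fun z : Plane => (f z : ℝ≥0∞) * (f (z + y) : ℝ≥0∞) := by fun_prop
  rw [← O.measurePreserving.lintegral_comp hm]
  refine lintegral_congr fun z => ?_
  rw [← hO, ← map_add, hiso (O z) z (O.norm_map z), hiso (O (z + x)) (z + x) (O.norm_map _)]

/-- Integrate over the parent first: the substitution z ↦ x - z turns f (x - z) f (y - z) into f z f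
(z + (y - x)). -/
lemma lintegral_offspringProb_mul {f : Plane → ℝ≥0} (hf : Measurable f) {A B : Set Plane} :
    ∫⁻ z, offspringProb f A z * offspringProb f B z =
      ∫⁻ x in A, ∫⁻ y in B, overlap f (y - x) := by
  have hprod : ∀ z, offspringProb f A z * offspringProb f B z =
      ∫⁻ x in A, ∫⁻ y in B, (f (x - z) : ℝ≥0∞) * (f (y - z) : ℝ≥0∞) := by
    intro z
    unfold offspringProb
    rw [← lintegral_mul_const _ (by fun_prop)]
    refine lintegral_congr fun x => ?_
    rw [← lintegral_const_mul _ (by fun_prop)]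
  simp_rw [hprod]
  rw [lintegral_lintegral_swap]
  · refine lintegral_congr fun x => ?_
    rw [lintegral_lintegral_swap]
    · refine lintegral_congr fun y => ?_
      rw [overlap, ← lintegral_sub_left_eq_self
        (fun z : Plane => (f z : ℝ≥0∞) * (f (z + (y - x)) : ℝ≥0∞)) x]
      refine lintegral_congr fun z => ?_
      rw [sub_add_sub_comm, add_comm x, add_sub_add_right_eq_sub]
    · refine Measurable.aemeasurable ?_
      unfold Function.uncurry
      fun_prop
  · refine Measurable.aemeasurable ?_
    exact Measurable.lintegral_prod_right' (f := fun q : (Plane × Plane) × Plane =>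
      (f (q.1.2 - q.1.1) : ℝ≥0∞) * (f (q.2 - q.1.1) : ℝ≥0∞)) (by fun_prop)

lemma clusterMomentDensity_norm {f : Plane → ℝ≥0} (hf : Measurable f)
    (hiso : ∀ x y : Plane, ‖x‖ = ‖y‖ → f x = f y) (lamP m : ℝ≥0) (x y : Plane) :
    clusterMomentDensity lamP m f ‖x - y‖ =
      ((m * lamP : ℝ≥0) : ℝ≥0∞) ^ 2 * (1 + (lamP : ℝ≥0∞)⁻¹ * overlap f (y - x)) := by
  rw [overlap_eq_of_norm_eq hf hiso
    (show ‖y - x‖ = ‖EuclideanSpace.single (0 : Fin 2) ‖x - y‖‖ by simp [norm_sub_rev])]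
  rfl

variable {Ω : Type*} [MeasurableSpace Ω] {P : Measure Ω} [IsProbabilityMeasure P]
  {Φ : Ω → Measure Plane} {lamP m : ℝ≥0} {f : Plane → ℝ≥0}

/-- The second-order moment density of a Poisson cluster process with isotropic displacements. -/
lemma IsPoissonClusterProcess.isSecondMomentDensity (h : IsPoissonClusterProcess P Φ lamP m f)
    (hlamP : 0 < lamP) (hf : Measurable f) (hf_one : ∫⁻ s, (f s : ℝ≥0∞) = 1)
    (hiso : ∀ x y : Plane, ‖x‖ = ‖y‖ → f x = f y) :
    IsSecondMomentDensity P Φ (clusterMomentDensity lamP m f) where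
  measurable := by
    exact ((((measurable_overlap hf).comp
      continuous_single_zero.measurable).const_mul _).const_add _).const_mul _
  moment A B hA hB := by
    rw [h.lintegral_apply_mul_apply hf hf_one hA hB, lintegral_offspringProb_mul hf]
    congr 1
    have ho : ∀ x : Plane, Measurable fun y => overlap f (y - x) := fun x =>
      (measurable_overlap hf).comp (by fun_prop)
    have hoo : Measurable fun x : Plane => ∫⁻ y in B, overlap f (y - x) :=
      Measurable.lintegral_prod_right (f := fun x y : Plane => overlap f (y - x))
        ((measurable_overlap hf).comp (by fun_prop))
    -- Positivity of λ_p is what makes (m λ_p)² λ_p⁻¹ equal to λ_p m².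
    have hl : (lamP : ℝ≥0∞) ≠ 0 := by exact_mod_cast hlamP.ne'
    have hinner : ∀ x : Plane, ∫⁻ y in B, clusterMomentDensity lamP m f ‖x - y‖ =
        ((m * lamP : ℝ≥0) : ℝ≥0∞) ^ 2 * volume B +
          lamP * m ^ 2 * ∫⁻ y in B, overlap f (y - x) := by
      intro x
      simp_rw [clusterMomentDensity_norm hf hiso, mul_add, mul_one]
      rw [lintegral_add_left measurable_const, setLIntegral_const]
      congr 1
      rw [← lintegral_const_mul _ (ho x)]
      refine lintegral_congr fun y => ?_
      rw [← mul_assoc]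
      congr 1
      push_cast
      rw [mul_pow, sq (lamP : ℝ≥0∞), mul_assoc, mul_assoc, ENNReal.mul_inv_cancel hl
        ENNReal.coe_ne_top, mul_one, mul_comm]
    simp_rw [hinner]
    rw [lintegral_add_left measurable_const, setLIntegral_const, lintegral_const_mul _ hoo]
    ring

end IsotropicDensity

/-! ### The identity on locally finite measures as an s-finite kernel. -/

section LocallyFiniteKernel

/-- The annulus of the points of norm in `[k, k + 1)`. -/
def annulus (k : ℕ) : Set Plane := (fun x : Plane => ⌊‖x‖⌋₊) ⁻¹' {k}

lemma measurableSet_annulus (k : ℕ) : MeasurableSet (annulus k) :=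
  (Nat.measurable_floor.comp measurable_norm) (measurableSet_singleton k)

lemma annulus_subset_ball (k : ℕ) : annulus k ⊆ Metric.ball 0 (k + 1 : ℕ) := by
  rintro x rfl
  rw [mem_ball_zero_iff]
  push_cast
  exact Nat.lt_floor_add_one _

/-- The measures whose mass in the `k`-th annulus is in `[n, n + 1)`. -/
def massInAnnulus (k n : ℕ) : Set (Measure Plane) :=
  {φ | (n : ℝ≥0∞) ≤ φ (annulus k) ∧ φ (annulus k) < (n : ℝ≥0∞) + 1}

lemma measurableSet_massInAnnulus (k n : ℕ) : MeasurableSet (massInAnnulus k n) :=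
  (Measure.measurable_coe (measurableSet_annulus k)) measurableSet_Ico

open Classical in
/-- The identity kernel on measures, cut off to be finite. -/
noncomputable def cutoffKernel (p : ℕ × ℕ) : Kernel (Measure Plane) Plane :=
  Kernel.piecewise (measurableSet_massInAnnulus p.1 p.2)
    (Kernel.restrict ⟨id, measurable_id⟩ (measurableSet_annulus p.1)) 0

lemma cutoffKernel_apply (p : ℕ × ℕ) (φ : Measure Plane) {A : Set Plane} (hA : MeasurableSet A) :
    cutoffKernel p φ A = (massInAnnulus p.1 p.2).indicator (fun φ => φ (A ∩ annulus p.1)) φ := by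
  classical
  rw [cutoffKernel, Kernel.piecewise_apply]
  by_cases h : φ ∈ massInAnnulus p.1 p.2
  · rw [if_pos h, indicator_of_mem h, Kernel.restrict_apply, Measure.restrict_apply hA]
    rfl
  · rw [if_neg h, indicator_of_notMem h]
    rfl

instance (p : ℕ × ℕ) : IsFiniteKernel (cutoffKernel p) := by
  refine ⟨(p.2 : ℝ≥0∞) + 1, by finiteness, fun φ => ?_⟩
  rw [cutoffKernel_apply p φ MeasurableSet.univ, univ_inter]
  by_cases h : φ ∈ massInAnnulus p.1 p.2
  · rw [indicator_of_mem h]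
    exact h.2.le
  · rw [indicator_of_notMem h]
    exact zero_le

/-- An s-finite kernel that is the identity on locally finite measures. -/
noncomputable def locallyFiniteKernel : Kernel (Measure Plane) Plane := Kernel.sum cutoffKernel

instance : IsSFiniteKernel locallyFiniteKernel := by
  unfold locallyFiniteKernel
  infer_instance

/-- The mass of each annulus is finite, so exactly one cutoff level, its integer part, is active
there; the annuli partition the plane. -/
lemma locallyFiniteKernel_apply {φ : Measure Plane} (hφ : ∀ n : ℕ, φ (Metric.ball 0 n) < ∞) :
    locallyFiniteKernel φ = φ := by
  ext A hA
  have hk : ∀ k, ∑' n, cutoffKernel (k, n) φ A = φ (A ∩ annulus k) := by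
    intro k
    have hlt : φ (annulus k) < ∞ := (measure_mono (annulus_subset_ball k)).trans_lt (hφ _)
    lift φ (annulus k) to ℝ≥0 using hlt.ne with x hx
    have hiff : ∀ n, φ ∈ massInAnnulus k n ↔ n = ⌊x⌋₊ := by
      intro n
      simp only [massInAnnulus, mem_ofPred_eq, ← hx]
      rw [eq_comm, Nat.floor_eq_iff (zero_le)]
      norm_cast
    rw [tsum_eq_single ⌊x⌋₊]
    · rw [cutoffKernel_apply _ _ hA, indicator_of_mem ((hiff _).2 rfl)]
    · intro n hn
      rw [cutoffKernel_apply _ _ hA, indicator_of_notMem fun h => hn ((hiff _).1 h)]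
  rw [locallyFiniteKernel, Kernel.sum_apply' _ _ hA, ENNReal.tsum_prod']
  simp_rw [hk]
  rw [← measure_iUnion _ fun k => hA.inter (measurableSet_annulus k)]
  · rw [← inter_iUnion]
    congr 1
    rw [inter_eq_left]
    intro x _
    exact mem_iUnion.2 ⟨_, rfl⟩
  · intro i j hij
    exact ((disjoint_singleton.2 hij).preimage _).mono inter_subset_right inter_subset_right

end LocallyFiniteKernel

/-! ### The load as the mass of an independent random set, and moments of the cell. -/

section CellLoad

variable {Ω' : Type*} [MeasurableSpace Ω'] {P' : Measure Ω'}
  {Ω : Type*} [MeasurableSpace Ω] {P : Measure Ω} [IsProbabilityMeasure P]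
  {lamB lamP m : ℝ≥0} {f : Plane → ℝ≥0}
  {Φb : Ω' → Measure Plane} {Φ₀ : Ω → Measure Plane} {Φu : Ω → Measure Plane}

lemma IsPoissonClusterProcess.ae_locallyFinite (h : IsPoissonClusterProcess P Φu lamP m f)
    (hf : Measurable f) (hf_one : ∫⁻ s, (f s : ℝ≥0∞) = 1) :
    ∀ᵐ ω ∂P, ∀ n : ℕ, Φu ω (Metric.ball 0 n) < ∞ := by
  refine ae_all_iff.2 fun n => ae_lt_top ?_ ?_
  · exact (Measure.measurable_coe Metric.isOpen_ball.measurableSet).comp h.measurable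
  · rw [h.lintegral_apply hf hf_one Metric.isOpen_ball.measurableSet]
    exact ENNReal.mul_ne_top ENNReal.coe_ne_top measure_ball_lt_top.ne

/-- Measurability of sections of a jointly measurable set holds for s-finite kernels, which is why
the identity on measures was replaced by the kernel built from cutoffs. -/
lemma measurable_locallyFiniteKernel_emptyRegion :
    Measurable fun p : Measure Plane × Measure Plane =>
      locallyFiniteKernel p.2 (emptyRegion p.1) := by
  have : MeasurableSet {q : (Measure Plane × Measure Plane) × Plane | q.2 ∈ emptyRegion q.1.1} :=
    measurableSet_mem_emptyRegion.preimage
      (by fun_prop : Measurable fun q : (Measure Plane × Measure Plane) × Plane => (q.1.1, q.2))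
  have h := Kernel.measurable_kernel_prodMk_left
    (κ := locallyFiniteKernel.comap (Prod.snd : Measure Plane × Measure Plane → _) measurable_snd)
    this
  simp only [Kernel.comap_apply] at h
  exact h

lemma ae_load_eq (hΦb : IsPoissonPP P' Φb lamB) (hlamB : 0 < lamB)
    (hΦ₀ : HasPalmLaw P' Φb lamB P Φ₀) (hΦu : IsPoissonClusterProcess P Φu lamP m f)
    (hf : Measurable f) (hf_one : ∫⁻ s, (f s : ℝ≥0∞) = 1) :
    (fun ω => Φu ω (voronoiCell (Φ₀ ω) 0)) =ᵐ[P]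
      fun ω => locallyFiniteKernel (Φu ω) (emptyRegion (Φ₀ ω)) := by
  filter_upwards [hΦu.ae_locallyFinite hf hf_one,
    hΦ₀.ae_mem_integerOnBase hΦb.toIsPointProcess hlamB] with ω h1 h2
  rw [locallyFiniteKernel_apply h1, voronoiCell_zero_eq_emptyRegion h2]

lemma aemeasurable_load (hΦb : IsPoissonPP P' Φb lamB) (hlamB : 0 < lamB)
    (hΦ₀ : HasPalmLaw P' Φb lamB P Φ₀) (hΦu : IsPoissonClusterProcess P Φu lamP m f)
    (hf : Measurable f) (hf_one : ∫⁻ s, (f s : ℝ≥0∞) = 1) :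
    AEMeasurable (fun ω => Φu ω (voronoiCell (Φ₀ ω) 0)) P :=
  ⟨_, measurable_locallyFiniteKernel_emptyRegion.comp (hΦ₀.measurable.prodMk hΦu.measurable),
    ae_load_eq hΦb hlamB hΦ₀ hΦu hf hf_one⟩

/-- The load of the cell is the number of users in an independent copy of the cell. -/
lemma lintegral_comp_load (hΦb : IsPoissonPP P' Φb lamB) (hlamB : 0 < lamB)
    (hΦ₀ : HasPalmLaw P' Φb lamB P Φ₀) (hΦu : IsPoissonClusterProcess P Φu lamP m f)
    (hf : Measurable f) (hf_one : ∫⁻ s, (f s : ℝ≥0∞) = 1) (hindep : IndepFun Φ₀ Φu P)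
    {G : ℝ≥0∞ → ℝ≥0∞} (hG : Measurable G) :
    ∫⁻ ω, G (Φu ω (voronoiCell (Φ₀ ω) 0)) ∂P =
      ∫⁻ ω, ∫⁻ ω', G (Φu ω' (emptyRegion (Φ₀ ω))) ∂P ∂P := by
  have key := hindep.lintegral_eq_lintegral_lintegral
    (F := fun p => G (locallyFiniteKernel p.2 (emptyRegion p.1))) hΦ₀.measurable hΦu.measurable
    (hG.comp measurable_locallyFiniteKernel_emptyRegion)
  dsimp only at key
  have h1 : ∫⁻ ω, G (Φu ω (voronoiCell (Φ₀ ω) 0)) ∂P =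
      ∫⁻ ω, G (locallyFiniteKernel (Φu ω) (emptyRegion (Φ₀ ω))) ∂P := by
    refine lintegral_congr_ae ?_
    filter_upwards [ae_load_eq hΦb hlamB hΦ₀ hΦu hf hf_one] with ω hω
    rw [hω]
  rw [h1, key]
  refine lintegral_congr fun ω => lintegral_congr_ae ?_
  filter_upwards [hΦu.ae_locallyFinite hf hf_one] with ω' h
  rw [locallyFiniteKernel_apply h]

lemma measurableSet_mem_emptyRegion_comp (hΦ₀ : Measurable Φ₀) :
    MeasurableSet {p : Ω × Plane | p.2 ∈ emptyRegion (Φ₀ p.1)} :=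
  measurableSet_mem_emptyRegion.preimage
    ((hΦ₀.comp measurable_fst).prodMk measurable_snd)

/-- Moments of second order of the cell of the typical point. -/
lemma HasPalmLaw.lintegral_emptyRegion_emptyRegion (hΦ₀ : HasPalmLaw P' Φb lamB P Φ₀)
    (hΦb : IsPoissonPP P' Φb lamB) (hlamB : 0 < lamB) {w : Plane → Plane → ℝ≥0∞}
    (hw : Measurable (Function.uncurry w)) :
    ∫⁻ ω, (∫⁻ x in emptyRegion (Φ₀ ω), ∫⁻ y in emptyRegion (Φ₀ ω), w x y) ∂P =
      ∫⁻ x, ∫⁻ y, ENNReal.ofReal (Real.exp (-(lamB *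
        volume.real (Metric.ball x ‖x‖ ∪ Metric.ball y ‖y‖)))) * w x y := by
  have hE := measurableSet_mem_emptyRegion_comp hΦ₀.measurable
  set T : Set (Ω × Plane × Plane) :=
    {q | q.2.1 ∈ emptyRegion (Φ₀ q.1) ∧ q.2.2 ∈ emptyRegion (Φ₀ q.1)} with hT
  have hTm : MeasurableSet T :=
    (hE.preimage (by fun_prop : Measurable fun q : Ω × Plane × Plane => (q.1, q.2.1))).inter
      (hE.preimage (by fun_prop : Measurable fun q : Ω × Plane × Plane => (q.1, q.2.2)))
  have hF : Measurable (T.indicator fun q => w q.2.1 q.2.2) :=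
    (hw.comp measurable_snd).indicator hTm
  have h1 : ∀ ω, ∫⁻ x in emptyRegion (Φ₀ ω), ∫⁻ y in emptyRegion (Φ₀ ω), w x y =
      ∫⁻ x, ∫⁻ y, T.indicator (fun q => w q.2.1 q.2.2) (ω, x, y) := by
    intro ω
    rw [← lintegral_indicator (measurableSet_emptyRegion _)]
    refine lintegral_congr fun x => ?_
    by_cases hx : x ∈ emptyRegion (Φ₀ ω)
    · rw [indicator_of_mem hx, ← lintegral_indicator (measurableSet_emptyRegion _)]
      refine lintegral_congr fun y => ?_
      by_cases hy : y ∈ emptyRegion (Φ₀ ω)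
      · rw [indicator_of_mem hy, indicator_of_mem (show (ω, x, y) ∈ T from ⟨hx, hy⟩)]
      · rw [indicator_of_notMem hy, indicator_of_notMem fun h : (ω, x, y) ∈ T => hy h.2]
    · rw [indicator_of_notMem hx]
      simp_rw [indicator_of_notMem fun h : (ω, x, _) ∈ T => hx h.1]
      simp
  simp_rw [h1]
  -- Bringing the expectation inside both area integrals leaves the probability that x and y both
  -- lie in the cell.
  rw [lintegral_lintegral_swap]
  · refine lintegral_congr fun x => ?_
    rw [lintegral_lintegral_swap]
    · refine lintegral_congr fun y => ?_
      rw [← hΦ₀.measure_mem_emptyRegion hΦb hlamB x y]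
      have : ∀ ω, T.indicator (fun q => w q.2.1 q.2.2) (ω, x, y) =
          {ω | x ∈ emptyRegion (Φ₀ ω) ∧ y ∈ emptyRegion (Φ₀ ω)}.indicator (fun _ => w x y) ω :=
        fun ω => rfl
      simp_rw [this]
      rw [lintegral_indicator_const, mul_comm]
      exact hTm.preimage (measurable_prodMk_right (y := (x, y)))
    · exact (hF.comp (by fun_prop : Measurable fun p : Ω × Plane => (p.1, x, p.2))).aemeasurable
  · refine Measurable.aemeasurable ?_
    exact Measurable.lintegral_prod_right'
      (f := fun q : (Ω × Plane) × Plane => T.indicator (fun q => w q.2.1 q.2.2) (q.1.1, q.1.2, q.2))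
      (hF.comp (by fun_prop : Measurable fun q : (Ω × Plane) × Plane => (q.1.1, q.1.2, q.2)))

/-- The mean area of the cell of the typical point. -/
lemma HasPalmLaw.lintegral_volume_emptyRegion (hΦ₀ : HasPalmLaw P' Φb lamB P Φ₀)
    (hΦb : IsPoissonPP P' Φb lamB) (hlamB : 0 < lamB) :
    ∫⁻ ω, volume (emptyRegion (Φ₀ ω)) ∂P = (lamB : ℝ≥0∞)⁻¹ := by
  have hE := measurableSet_mem_emptyRegion_comp hΦ₀.measurable
  have h1 : ∫⁻ ω, volume (emptyRegion (Φ₀ ω)) ∂P =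
      (P.prod volume) {p : Ω × Plane | p.2 ∈ emptyRegion (Φ₀ p.1)} :=
    (Measure.prod_apply hE).symm
  rw [h1, Measure.prod_apply_symm hE]
  have h2 : ∀ y : Plane, P ((fun ω => (ω, y)) ⁻¹' {p : Ω × Plane | p.2 ∈ emptyRegion (Φ₀ p.1)}) =
      ENNReal.ofReal (Real.exp (-(lamB * volume.real (Metric.ball y ‖y‖)))) := by
    intro y
    have := hΦ₀.measure_mem_emptyRegion hΦb hlamB y y
    rw [union_self] at this
    rw [← this]
    simp
  simp_rw [h2]
  rw [lintegral_exp_neg_volume_ball (by exact_mod_cast hlamB), ENNReal.ofReal_inv_of_pos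
    (by exact_mod_cast hlamB), ENNReal.ofReal_coe_nnreal]

/-- The union of two discs has at least half the sum of their areas, so the void probability is at
most a product of two Gaussians with λ_b/2 in place of λ_b, and the double integral factors. -/
lemma HasPalmLaw.lintegral_volume_emptyRegion_sq_lt_top (hΦ₀ : HasPalmLaw P' Φb lamB P Φ₀)
    (hΦb : IsPoissonPP P' Φb lamB) (hlamB : 0 < lamB) :
    ∫⁻ ω, volume (emptyRegion (Φ₀ ω)) * volume (emptyRegion (Φ₀ ω)) ∂P < ∞ := by
  have h := hΦ₀.lintegral_emptyRegion_emptyRegion hΦb hlamB (w := fun _ _ => 1) measurable_const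
  simp only [lintegral_const, Measure.restrict_apply_univ, one_mul, mul_one] at h
  rw [h]
  set c : ℝ := lamB / 2
  have hc : 0 < c := by
    have : (0 : ℝ) < lamB := by exact_mod_cast hlamB
    positivity
  set e : Plane → ℝ≥0∞ := fun x =>
    ENNReal.ofReal (Real.exp (-(c * volume.real (Metric.ball x ‖x‖)))) with he
  have he_int : ∫⁻ x, e x = ENNReal.ofReal c⁻¹ := lintegral_exp_neg_volume_ball hc
  have hle : ∀ x y : Plane, ENNReal.ofReal (Real.exp (-(lamB *
      volume.real (Metric.ball x ‖x‖ ∪ Metric.ball y ‖y‖)))) ≤ e x * e y := by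
    intro x y
    rw [he, ← ENNReal.ofReal_mul (by positivity), ← Real.exp_add]
    refine ENNReal.ofReal_le_ofReal (Real.exp_le_exp.2 ?_)
    have hfin : volume (Metric.ball x ‖x‖ ∪ Metric.ball y ‖y‖) ≠ ∞ :=
      ((measure_union_le _ _).trans_lt (ENNReal.add_lt_top.2
        ⟨measure_ball_lt_top, measure_ball_lt_top⟩)).ne
    have h1 : volume.real (Metric.ball x ‖x‖) ≤
        volume.real (Metric.ball x ‖x‖ ∪ Metric.ball y ‖y‖) :=
      measureReal_mono subset_union_left hfin
    have h2 : volume.real (Metric.ball y ‖y‖) ≤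
        volume.real (Metric.ball x ‖x‖ ∪ Metric.ball y ‖y‖) :=
      measureReal_mono subset_union_right hfin
    have hcl : (lamB : ℝ) = c + c := by simp [c]
    rw [hcl]
    nlinarith
  refine (lintegral_mono fun x => lintegral_mono fun y => hle x y).trans_lt ?_
  have hex : ∀ x, e x ≠ ∞ := fun x => ENNReal.ofReal_ne_top
  simp_rw [lintegral_const_mul' _ _ (hex _), he_int]
  rw [lintegral_mul_const' _ _ ENNReal.ofReal_ne_top, he_int]
  exact ENNReal.mul_lt_top ENNReal.ofReal_lt_top ENNReal.ofReal_lt_top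

end CellLoad

/-! ### First and second moments of the load. -/

section CellLoadMoments

variable {Ω' : Type*} [MeasurableSpace Ω'] {P' : Measure Ω'}
  {Ω : Type*} [MeasurableSpace Ω] {P : Measure Ω} [IsProbabilityMeasure P]
  {lamB lamP m : ℝ≥0} {f : Plane → ℝ≥0}
  {Φb : Ω' → Measure Plane} {Φ₀ : Ω → Measure Plane} {Φu : Ω → Measure Plane}

lemma lintegral_lintegral_count_emptyRegion (hΦb : IsPoissonPP P' Φb lamB) (hlamB : 0 < lamB)
    (hΦ₀ : HasPalmLaw P' Φb lamB P Φ₀) (hΦu : IsPoissonClusterProcess P Φu lamP m f)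
    (hf : Measurable f) (hf_one : ∫⁻ s, (f s : ℝ≥0∞) = 1) :
    ∫⁻ ω, ∫⁻ ω', Φu ω' (emptyRegion (Φ₀ ω)) ∂P ∂P = ((m * lamP / lamB : ℝ≥0) : ℝ≥0∞) := by
  simp_rw [hΦu.lintegral_apply hf hf_one (measurableSet_emptyRegion _)]
  rw [lintegral_const_mul' _ _ ENNReal.coe_ne_top,
    hΦ₀.lintegral_volume_emptyRegion hΦb hlamB, ENNReal.coe_div hlamB.ne', div_eq_mul_inv]

lemma lintegral_load_sq_lt_top (hΦb : IsPoissonPP P' Φb lamB) (hlamB : 0 < lamB)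
    (hΦ₀ : HasPalmLaw P' Φb lamB P Φ₀) (hΦu : IsPoissonClusterProcess P Φu lamP m f)
    (hf : Measurable f) (hf_one : ∫⁻ s, (f s : ℝ≥0∞) = 1) (hindep : IndepFun Φ₀ Φu P) :
    ∫⁻ ω, Φu ω (voronoiCell (Φ₀ ω) 0) ^ 2 ∂P < ∞ := by
  rw [lintegral_comp_load hΦb hlamB hΦ₀ hΦu hf hf_one hindep (G := fun x => x ^ 2) (by fun_prop)]
  -- Bounding one of the two offspring probabilities by 1 bounds the cluster term by the area. No
  -- isotropy or moment density is needed.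
  have hprob : ∀ (A : Set Plane) (z : Plane), offspringProb f A z ≤ 1 := by
    intro A z
    rw [← hf_one, ← lintegral_sub_right_eq_self _ z]
    exact setLIntegral_le_lintegral _ _
  have hle : ∀ ω, ∫⁻ ω', Φu ω' (emptyRegion (Φ₀ ω)) ^ 2 ∂P ≤
      (∫⁻ ω', Φu ω' (emptyRegion (Φ₀ ω)) ∂P + lamP * m ^ 2 * volume (emptyRegion (Φ₀ ω))) +
      ((m * lamP : ℝ≥0) : ℝ≥0∞) ^ 2 *
        (volume (emptyRegion (Φ₀ ω)) * volume (emptyRegion (Φ₀ ω))) := by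
    intro ω
    have hA := measurableSet_emptyRegion (Φ₀ ω)
    simp_rw [sq (Φu _ _)]
    rw [hΦu.lintegral_apply_mul_apply hf hf_one hA hA, inter_self, add_assoc]
    refine add_le_add_right ?_ _
    rw [add_comm]
    refine add_le_add (mul_le_mul_right ?_ _) ?_
    · rw [← lintegral_offspringProb hf hf_one (emptyRegion (Φ₀ ω))]
      exact lintegral_mono fun z => mul_le_of_le_one_right' (hprob _ z)
    · exact le_of_eq (by ring)
  have hm : Measurable fun ω => volume (emptyRegion (Φ₀ ω)) :=
    measurable_measure_prodMk_left (ν := volume)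
      (measurableSet_mem_emptyRegion_comp hΦ₀.measurable)
  refine (lintegral_mono hle).trans_lt ?_
  rw [lintegral_add_right _ ((hm.fun_mul hm).const_mul _), lintegral_add_right _ (hm.const_mul _),
    lintegral_lintegral_count_emptyRegion hΦb hlamB hΦ₀ hΦu hf hf_one,
    lintegral_const_mul _ hm, lintegral_const_mul _ (hm.fun_mul hm),
    hΦ₀.lintegral_volume_emptyRegion hΦb hlamB]
  have hsq := hΦ₀.lintegral_volume_emptyRegion_sq_lt_top hΦb hlamB
  have hinv : (lamB : ℝ≥0∞)⁻¹ < ∞ := ENNReal.inv_lt_top.2 (by exact_mod_cast hlamB)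
  finiteness

/-- The second moment of the typical cell load in terms of a second-order moment density. -/
lemma lintegral_load_sq_eq (hΦb : IsPoissonPP P' Φb lamB) (hlamB : 0 < lamB)
    (hΦ₀ : HasPalmLaw P' Φb lamB P Φ₀) (hΦu : IsPoissonClusterProcess P Φu lamP m f)
    (hf : Measurable f) (hf_one : ∫⁻ s, (f s : ℝ≥0∞) = 1) (hindep : IndepFun Φ₀ Φu P)
    {ρ : ℝ → ℝ≥0∞} (hρ : IsSecondMomentDensity P Φu ρ) :
    ∫⁻ ω, Φu ω (voronoiCell (Φ₀ ω) 0) ^ 2 ∂P =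
      ((m * lamP / lamB : ℝ≥0) : ℝ≥0∞) +
        ENNReal.ofReal (2 * Real.pi) *
          ∫⁻ θ in Ioc 0 (2 * Real.pi), ∫⁻ x₂ in Ioi (0 : ℝ), ∫⁻ x₁ in Ioi (0 : ℝ),
            ENNReal.ofReal (Real.exp (-(lamB * unionArea x₁ x₂ (thirdSide x₁ x₂ θ)))) *
              ρ (thirdSide x₁ x₂ θ) * ENNReal.ofReal (x₁ * x₂) := by
  rw [lintegral_comp_load hΦb hlamB hΦ₀ hΦu hf hf_one hindep (G := fun x => x ^ 2) (by fun_prop)]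
  -- The cell is a fixed set for the inner expectation, so the defining identity of ρ applies with
  -- both sets equal to it.
  have hmom : ∀ ω, ∫⁻ ω', Φu ω' (emptyRegion (Φ₀ ω)) ^ 2 ∂P =
      ∫⁻ ω', Φu ω' (emptyRegion (Φ₀ ω)) ∂P +
        ∫⁻ x in emptyRegion (Φ₀ ω), ∫⁻ y in emptyRegion (Φ₀ ω), ρ ‖x - y‖ := by
    intro ω
    have hA := measurableSet_emptyRegion (Φ₀ ω)
    simp_rw [sq (Φu _ _)]
    rw [hρ.moment _ _ hA hA, inter_self]
  have hm : Measurable fun ω => ∫⁻ ω', Φu ω' (emptyRegion (Φ₀ ω)) ∂P := by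
    simp_rw [hΦu.lintegral_apply hf hf_one (measurableSet_emptyRegion _)]
    exact (measurable_measure_prodMk_left (ν := volume)
      (measurableSet_mem_emptyRegion_comp hΦ₀.measurable)).const_mul _
  have hw : Measurable (Function.uncurry fun x y : Plane => ρ ‖x - y‖) :=
    hρ.measurable.comp (by fun_prop : Measurable fun p : Plane × Plane => ‖p.1 - p.2‖)
  simp_rw [hmom]
  rw [lintegral_add_left hm,
    lintegral_lintegral_count_emptyRegion hΦb hlamB hΦ₀ hΦu hf hf_one,
    hΦ₀.lintegral_emptyRegion_emptyRegion hΦb hlamB hw]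
  congr 1
  refine lintegral_lintegral_norm_eq
    (h := fun r₁ r₂ d => ENNReal.ofReal (Real.exp (-(lamB * unionArea r₁ r₂ d))) * ρ d) ?_ ?_
  · refine Measurable.mul ?_ hw
    exact ((measurable_volume_ball_union.ennreal_toReal.const_mul _).neg.exp).ennreal_ofReal
  · intro x y
    rw [Measure.real, volume_ball_union_ball, ENNReal.toReal_ofReal (by
      unfold unionArea; exact measureReal_nonneg)]

end CellLoadMoments

theorem lemma1
    {Ω' : Type*} [MeasurableSpace Ω'] (P' : Measure Ω') [IsProbabilityMeasure P']
    {Ω : Type*} [MeasurableSpace Ω] (P : Measure Ω) [IsProbabilityMeasure P]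
    (lamB lamP m : ℝ≥0) (hlamB : 0 < lamB) (hlamP : 0 < lamP)
    (f : Plane → ℝ≥0) (hf : Measurable f) (hf_one : ∫⁻ s, (f s : ℝ≥0∞) = 1)
    -- the base stations, and the base stations seen from the typical one
    (Φb : Ω' → Measure Plane) (hΦb : IsPoissonPP P' Φb lamB)
    (Φ₀ : Ω → Measure Plane) (hΦ₀ : HasPalmLaw P' Φb lamB P Φ₀)
    -- the users
    (Φu : Ω → Measure Plane) (hΦu : IsPoissonClusterProcess P Φu lamP m f)
    (hindep : IndepFun Φ₀ Φu P) :
    -- the typical cell load is an honest random variable with finite second moment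
    AEMeasurable (fun ω => Φu ω (voronoiCell (Φ₀ ω) 0)) P ∧
    ∫⁻ ω, Φu ω (voronoiCell (Φ₀ ω) 0) ^ 2 ∂P < ∞ ∧
    -- its mean
    ∫⁻ ω, Φu ω (voronoiCell (Φ₀ ω) 0) ∂P = ((m * lamP / lamB : ℝ≥0) : ℝ≥0∞) ∧
    -- its second moment
    (∀ ρ : ℝ → ℝ≥0∞, IsSecondMomentDensity P Φu ρ →
      ∫⁻ ω, Φu ω (voronoiCell (Φ₀ ω) 0) ^ 2 ∂P =
        ((m * lamP / lamB : ℝ≥0) : ℝ≥0∞) +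
          ENNReal.ofReal (2 * Real.pi) *
            ∫⁻ θ in Ioc 0 (2 * Real.pi), ∫⁻ x₂ in Ioi (0 : ℝ), ∫⁻ x₁ in Ioi (0 : ℝ),
              ENNReal.ofReal (Real.exp (-(lamB * unionArea x₁ x₂ (thirdSide x₁ x₂ θ)))) *
                ρ (thirdSide x₁ x₂ θ) * ENNReal.ofReal (x₁ * x₂)) ∧
    -- the second-order moment density, when the offspring are isotropic
    ((∀ x y : Plane, ‖x‖ = ‖y‖ → f x = f y) →
      IsSecondMomentDensity P Φu (clusterMomentDensity lamP m f)) := by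
  refine ⟨aemeasurable_load hΦb hlamB hΦ₀ hΦu hf hf_one,
    lintegral_load_sq_lt_top hΦb hlamB hΦ₀ hΦu hf hf_one hindep, ?_,
    fun ρ hρ => lintegral_load_sq_eq hΦb hlamB hΦ₀ hΦu hf hf_one hindep hρ,
    hΦu.isSecondMomentDensity hlamP hf hf_one⟩
  rw [lintegral_comp_load hΦb hlamB hΦ₀ hΦu hf hf_one hindep (G := fun x => x) measurable_id]
  exact lintegral_lintegral_count_emptyRegion hΦb hlamB hΦ₀ hΦu hf hf_one
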